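/- Let $\varphi:\mathbb C\times\mathbb C\to[0,\infty)$ be continuous and satisfy: (inc) for all $s_1,s_2\in\mathbb C$, $|s_1|\le|s_2|$ implies $\varphi(s_1,t)\le\varphi(s_2,t)$ and $\varphi(t,s_1)\le\varphi(t,s_2)$ for all $t\in\mathbb C$, and $|s_1|<|s_2|$ implies $\varphi(s_1,t)<\varphi(s_2,t)$ and $\varphi(t,s_1)<\varphi(t,s_2)$ for all $t\in\mathbb C\setminus\{0\}$; (con) for all $n\ge1$ and $s_1,\dots,s_n,t\in\mathbb C$, $\varphi(\frac1n\sum_i s_i,t)\le\frac1n\sum_i\varphi(s_i,t)$ and $\varphi(t,\frac1n\sum_i s_i)\le\frac1n\sum_i\varphi(t,s_i)$. For a locally compact Hausdorff space $X$, let $C_0(X)$ be the space of continuous complex functions on $X$ vanishing at infinity, with supremum norm $\|\cdot\|$, and for $f,g\in C_0(X)$ put $\varphi(f,g)(x)=\varphi(f(x),g(x))$, $\rho_+(f,g)=\|\varphi(f,g)\|+\|\varphi(g,f)\|$ and $\rho_{\max}(f,g)=\max(\|\varphi(f,g)\|,\|\varphi(g,f)\|)$. A function algebra on $X$ is a closed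 subalgebra $\mathcal A$ of $C_0(X)$ such that for distinct $x,y\in X$ some $f\in\mathcal A$ has $f(x)\ne f(y)$, and for each $x\in X$ some $g\in\mathcal A$ has $g(x)\neq0$. Its Choquet boundary $\mathrm{Ch}(\mathcal A)$ is the set of $x\in X$ for which the evaluation functional at $x$ is an extreme point of the closed unit ball of $\mathcal A^*$. For $A\subseteq C_0(X)$, $\delta(A)$ is the set of $x\in X$ such that for every $\epsilon>0$ and every neighbourhood $V$ of $x$ there is $f\in A$ with $f(x)=1=\|f\|$ and $|f|<\epsilon$ on $X\setminus V$; moreover $|A|=\{|f|:f\in A\}$. Let $X,Y$ be locally compact Hausdorff spaces, and let $A,B$ be either linear subspaces of $C_0(X)$ and $C_0(Y)$, or positive cones $\{f\in E: f\ge0\}$ of linear subspaces $E$ of $C_0(X)$ and $C_0(Y)$, respectively. Suppose that $\delta(A)=\mathrm{Ch}(\mathcal A)$ and $\delta(B)=\mathrm{Ch}(\mathcal B)$ for some function algebras $\mathcal A$ on $X$ and $\mathcal B$ on $Y$ with $|A|\subseteq|\mathcal A|$ and $|B|\subseteq|\mathcal B|$. Let $\rho\in\{\rho_+,\rho_{\max}\}$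 and let $T:A\to B$ be a surjective map with $\rho(Tf,Tg)=\rho(f,g)$ for all $f,g\in A$. Then $T$ induces a bijection $\Phi:\mathrm{Ch}(\mathcal B)\to\mathrm{Ch}(\mathcal A)$, in the sense that for every $y\in\mathrm{Ch}(\mathcal B)$ and every $r>0$, $\Phi(y)$ is the unique point $x\in\mathrm{Ch}(\mathcal A)$ such that $|f(x)|=\|f\|$ for all $f\in A$ with $Tf\in rV_y(B)$, where $V_y(B)=\{g\in B:g(y)=1=\|g\|\}$. Moreover: (i) if $\rho=\rho_{\max}$, then $\Phi$ is a homeomorphism and $|Tf(y)|=|f(\Phi(y))|$ for all $f\in A$ and $y\in\mathrm{Ch}(\mathcal B)$; (ii) if $\rho=\rho_+$ and either (a) $\varphi(t,0)=0=\varphi(0,t)$ for all $t\ge0$, or (b) $\varphi(t,a)\to\infty$ and $\varphi(a,t)\to\infty$ as $t\to\infty$ for every $a>0$, then $\Phi$ is a homeomorphism and $|Tf(y)|=|f(\Phi(y))|$ for all $f\in A$ and $y\in\mathrm{Ch}(\mathcal B)$. -/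

import Mathlib

open Filter Topology ZeroAtInfty

namespace CompModulus

/-- The property (inc): `φ` is increasing in modulus in each variable, and strictly increasing
in modulus in each variable when the other variable is nonzero. -/
def Inc (φ : ℂ × ℂ → ℝ) : Prop :=
  (∀ s₁ s₂ : ℂ, ‖s₁‖ ≤ ‖s₂‖ → ∀ t : ℂ, φ (s₁, t) ≤ φ (s₂, t) ∧ φ (t, s₁) ≤ φ (t, s₂)) ∧
  (∀ s₁ s₂ : ℂ, ‖s₁‖ < ‖s₂‖ → ∀ t : ℂ, t ≠ 0 → φ (s₁, t) < φ (s₂, t) ∧ φ (t, s₁) < φ (t, s₂))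

/-- The property (con): convexity in each variable with respect to arithmetic means. -/
def Con (φ : ℂ × ℂ → ℝ) : Prop :=
  ∀ n : ℕ, 0 < n → ∀ (s : Fin n → ℂ) (t : ℂ),
    φ ((1 / (n : ℂ)) * ∑ i, s i, t) ≤ (1 / (n : ℝ)) * ∑ i, φ (s i, t) ∧
    φ (t, (1 / (n : ℂ)) * ∑ i, s i) ≤ (1 / (n : ℝ)) * ∑ i, φ (t, s i)

section Dual

variable {V : Type*} [NormedAddCommGroup V] [NormedSpace ℂ V]

/-- The restriction of a bounded functional to a subspace. -/
noncomputable def restrict (E : Submodule ℂ V) (e : StrongDual ℂ V) : StrongDual ℂ E :=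
  e.comp E.subtypeL

/-- The extreme points of the closed unit ball of the dual of a subspace `E`. -/
def dualBallExtreme (E : Submodule ℂ V) : Set (StrongDual ℂ E) :=
  Set.extremePoints ℝ {ψ : StrongDual ℂ E | ‖ψ‖ ≤ 1}

end Dual

section Space

variable {X : Type*} [TopologicalSpace X]

/-- The supremum norm of the function `φ(f, g) : x ↦ φ (f x, g x)`. -/
noncomputable def normPhi (φ : ℂ × ℂ → ℝ) (f g : C₀(X, ℂ)) : ℝ :=
  ⨆ x, ‖φ (f x, g x)‖

/-- For continuous `φ` the supremum in `normPhi` is over a bounded set. -/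
theorem bddAbove_normPhi {φ : ℂ × ℂ → ℝ} (hφ : Continuous φ) (f g : C₀(X, ℂ)) :
    BddAbove (Set.range fun x => ‖φ (f x, g x)‖) := by
  have hK : IsCompact (Metric.closedBall (0 : ℂ) ‖f.toBCF‖ ×ˢ
      Metric.closedBall (0 : ℂ) ‖g.toBCF‖) :=
    (isCompact_closedBall _ _).prod (isCompact_closedBall _ _)
  obtain ⟨C, hC⟩ := hK.exists_bound_of_continuousOn hφ.continuousOn
  refine ⟨C, ?_⟩
  rintro _ ⟨x, rfl⟩
  refine hC _ ⟨?_, ?_⟩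
  · simpa using f.toBCF.norm_coe_le_norm x
  · simpa using g.toBCF.norm_coe_le_norm x

/-- `ρ₊(f, g) = ‖φ(f, g)‖ + ‖φ(g, f)‖`. -/
noncomputable def rhoPlus (φ : ℂ × ℂ → ℝ) (f g : C₀(X, ℂ)) : ℝ :=
  normPhi φ f g + normPhi φ g f

/-- `ρ_max(f, g) = max (‖φ(f, g)‖, ‖φ(g, f)‖)`. -/
noncomputable def rhoMax (φ : ℂ × ℂ → ℝ) (f g : C₀(X, ℂ)) : ℝ :=
  max (normPhi φ f g) (normPhi φ g f)

/-- `A` is (the underlying set of) a linear subspace of `C₀(X)`. -/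
def IsSubspace (A : Set C₀(X, ℂ)) : Prop :=
  ∃ E : Submodule ℂ C₀(X, ℂ), A = E

/-- `A` is the positive cone of some linear subspace of `C₀(X)`. -/
def IsPositiveCone (A : Set C₀(X, ℂ)) : Prop :=
  ∃ E : Submodule ℂ C₀(X, ℂ), A = {f | f ∈ E ∧ ∀ x, 0 ≤ (f x).re ∧ (f x).im = 0}

/-- The set `δ(A)` of strong boundary points of `A`. -/
def strongBoundary (A : Set C₀(X, ℂ)) : Set X :=
  {x | ∀ ε : ℝ, 0 < ε → ∀ V ∈ 𝓝 x,
    ∃ f ∈ A, f x = 1 ∧ ‖f‖ = 1 ∧ ∀ z, z ∉ V → ‖f z‖ < ε}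

/-- The evaluation functional `f ↦ f x` on `C₀(X)`. -/
noncomputable def evalFunctional (x : X) : StrongDual ℂ C₀(X, ℂ) :=
  LinearMap.mkContinuous
    { toFun := fun f : C₀(X, ℂ) => f x
      map_add' := fun _ _ => rfl
      map_smul' := fun _ _ => rfl } 1
    (fun f => by
      rw [one_mul]
      exact f.toBCF.norm_coe_le_norm x)

/-- The Choquet boundary `Ch(E)` of a subspace `E` of `C₀(X)`: the points `x` whose evaluation
functional `e_x` on `E` is an extreme point of the closed unit ball of the dual of `E`. -/
def choquetBoundary (E : Submodule ℂ C₀(X, ℂ)) : Set X :=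
  {x | restrict E (evalFunctional x) ∈ dualBallExtreme E}

/-- A function algebra on `X`: a closed subalgebra of `C₀(X)` that strongly separates points. -/
structure IsFunctionAlgebra (𝒜 : NonUnitalSubalgebra ℂ C₀(X, ℂ)) : Prop where
  isClosed : IsClosed (𝒜 : Set C₀(X, ℂ))
  separates : ∀ x y : X, x ≠ y → ∃ f ∈ 𝒜, f x ≠ f y
  nonvanishing : ∀ x : X, ∃ g ∈ 𝒜, g x ≠ 0

/-- `|A| = {|f| : f ∈ A}`. -/
def absSet (A : Set C₀(X, ℂ)) : Set (X → ℝ) :=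
  (fun f x => ‖f x‖) '' A

/-- `V_x(A) = {f ∈ A : f(x) = 1 = ‖f‖}`. -/
def peakers (A : Set C₀(X, ℂ)) (x : X) : Set C₀(X, ℂ) :=
  {f | f ∈ A ∧ f x = 1 ∧ ‖f‖ = 1}

/-- `M(f) = {x : |f(x)| = ‖f‖}`. -/
def maxModulusSet (f : C₀(X, ℂ)) : Set X :=
  {x | ‖f x‖ = ‖f‖}

variable {Y : Type*} [TopologicalSpace Y]

/-- For `T : A → B`, the set `⋂ {M(f) : f ∈ A, T f ∈ r V_y(B)}`. -/
def inducedSet {A : Set C₀(X, ℂ)} {B : Set C₀(Y, ℂ)} (T : A → B) (r : ℝ) (y : Y) : Set X :=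
  {x | ∀ f : A, (T f : C₀(Y, ℂ)) ∈ (fun v => (r : ℂ) • v) '' peakers B y →
    x ∈ maxModulusSet (f : C₀(X, ℂ))}

end Space

end CompModulus

namespace CompModulus

/-! ### Norms and maximum-modulus points in `C₀(X, ℂ)` -/

section Norm

variable {X : Type*} [TopologicalSpace X]

/-! The number `rho c φ f k` detects `‖f x‖` at a strong boundary point `x` when `k` runs over
peakers at `x`. If `‖f x‖ ≥ s` and `‖k x‖ ≥ R`, then `rho c φ f k ≥ rhoConst c φ s R`. If `‖f x‖ <
s`, a sufficiently high and narrow peaker makes `rho` drop strictly below that value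
(`exists_large_rho_lt`): near `x` strict monotonicity does it, and away from `x` one uses that
convexity forces `φ(R, t) → ∞` for `t ≠ 0`. Functions of norm `r` can be tested at height `r`
itself.

For fixed `y` and `r`, consider the functions `f` that correspond to peakers of height `r` at `y`.
Their maximum-modulus sets, cut down to the boundary, are directed because midpoints of peakers are
peakers and `rho` is midpoint convex. Compactness gives a common point, and the Choquet boundary
supplies one on `strongBoundary A` (`inducedPoints_nonempty`). Here Krein–Milman is applied to the
functionals agreeing with the evaluation wherever it attains the norm; an extreme one extends to an
extreme point of the dual ball of `C₀(X, ℂ)`, which is a multiple of an evaluation.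

The relation between `x` and `y` so obtained is symmetric, single valued and independent of `r`.
Peakers at matched points therefore correspond to functions of the same modulus there, and testing
against them at both ends gives `‖g y‖ = ‖f x‖`; continuity follows. Using a two-sided total
relation in place of `T` makes every argument available in both directions without injectivity. Sum
and maximum are treated together, through the three properties in `IsCombination`. -/

theorem norm_apply_le (f : C₀(X, ℂ)) (x : X) : ‖f x‖ ≤ ‖f‖ :=
  f.toBCF.norm_coe_le_norm x

theorem norm_le_of_forall_apply_le {f : C₀(X, ℂ)} {C : ℝ} (hC : 0 ≤ C) (h : ∀ x, ‖f x‖ ≤ C) :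
    ‖f‖ ≤ C :=
  (f.toBCF.norm_le hC).2 h

theorem norm_eq_of_norm_apply_eq {f g : C₀(X, ℂ)} (h : ∀ x, ‖f x‖ = ‖g x‖) : ‖f‖ = ‖g‖ :=
  le_antisymm
    (norm_le_of_forall_apply_le (norm_nonneg g) fun x => (h x).trans_le (norm_apply_le g x))
    (norm_le_of_forall_apply_le (norm_nonneg f) fun x => (h x).symm.trans_le (norm_apply_le f x))

theorem isCompact_setOf_le_norm_apply (f : C₀(X, ℂ)) {c : ℝ} (hc : 0 < c) :
    IsCompact {x | c ≤ ‖f x‖} := by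
  have h : {x | ‖f x‖ < c} ∈ cocompact X := by
    have := f.zero_at_infty'.norm
    simp only [norm_zero] at this
    exact this.eventually (gt_mem_nhds hc)
  obtain ⟨K, hK, hKc⟩ := mem_cocompact.1 h
  refine hK.of_isClosed_subset (isClosed_le continuous_const (map_continuous f).norm) ?_
  intro x hx
  by_contra hxK
  exact not_lt.2 (show c ≤ ‖f x‖ from hx) (hKc hxK)

theorem exists_norm_apply_eq_norm {f : C₀(X, ℂ)} (hf : f ≠ 0) : ∃ x, ‖f x‖ = ‖f‖ := by
  have hpos : 0 < ‖f‖ := norm_pos_iff.2 hf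
  have hne : ({x | ‖f‖ / 2 ≤ ‖f x‖}).Nonempty := by
    by_contra h
    rw [Set.not_nonempty_iff_eq_empty] at h
    have : ‖f‖ ≤ ‖f‖ / 2 := norm_le_of_forall_apply_le (by positivity) fun x => by
      by_contra hx
      exact (Set.eq_empty_iff_forall_notMem.1 h x) (not_le.1 hx).le
    linarith
  obtain ⟨x, hx, hmax⟩ := (isCompact_setOf_le_norm_apply f (half_pos hpos)).exists_isMaxOn hne
    (map_continuous f).norm.continuousOn
  refine ⟨x, le_antisymm (norm_apply_le f x) (norm_le_of_forall_apply_le (norm_nonneg _) ?_)⟩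
  intro z
  by_cases hz : ‖f‖ / 2 ≤ ‖f z‖
  · exact hmax hz
  · exact (not_le.1 hz).le.trans hx

/-- A compactly supported real function, as an element of `C₀(X, ℂ)`. -/
noncomputable def ofRealCompactSupport (u : C(X, ℝ)) (hu : HasCompactSupport u) : C₀(X, ℂ) :=
  ⟨⟨fun x => (u x : ℂ), Complex.continuous_ofReal.comp u.continuous⟩, by
    have : HasCompactSupport fun x => (u x : ℂ) := hu.comp_left (g := Complex.ofReal) (by simp)
    exact this.is_zero_at_infty⟩

@[simp]
theorem ofRealCompactSupport_apply (u : C(X, ℝ)) (hu : HasCompactSupport u) (x : X) :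
    ofRealCompactSupport u hu x = (u x : ℂ) := rfl

end Norm

/-! ### Indecomposability of extreme functionals -/

section Dual

variable {V : Type*} [NormedAddCommGroup V] [NormedSpace ℂ V]

variable (V) in
/-- The extreme points of the closed unit ball of the dual of `V`. -/
def unitBallExtreme : Set (StrongDual ℂ V) :=
  Set.extremePoints ℝ {ψ : StrongDual ℂ V | ‖ψ‖ ≤ 1}

/-- An extreme point of the dual ball is indecomposable with respect to norm-additive
decompositions. -/
theorem exists_eq_smul_of_mem_unitBallExtreme {ψ : StrongDual ℂ V} (hψ : ψ ∈ unitBallExtreme V)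
    (ψ₁ : StrongDual ℂ V) (hle : ‖ψ₁‖ + ‖ψ - ψ₁‖ ≤ ‖ψ‖) : ∃ c : ℂ, ψ₁ = c • ψ := by
  set ψ₂ := ψ - ψ₁ with hψ₂
  have hn : ‖ψ‖ ≤ 1 := hψ.1
  rcases (norm_nonneg ψ₁).eq_or_lt with ha | ha
  · exact ⟨0, by rw [norm_eq_zero.1 ha.symm]; exact (zero_smul ℂ ψ).symm⟩
  rcases (norm_nonneg ψ₂).eq_or_lt with hb | hb
  · exact ⟨1, by rw [one_smul, ← sub_eq_zero.1 (norm_eq_zero.1 hb.symm)]⟩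
  set a := ‖ψ₁‖
  set b := ‖ψ₂‖
  have hab : 0 < a + b := by positivity
  have hmem : ψ ∈ openSegment ℝ (((a + b) / a) • ψ₁) (((a + b) / b) • ψ₂) := by
    refine ⟨a / (a + b), b / (a + b), by positivity, by positivity, by field_simp, ?_⟩
    rw [smul_smul, smul_smul]
    have e1 : a / (a + b) * ((a + b) / a) = 1 := by field_simp
    have e2 : b / (a + b) * ((a + b) / b) = 1 := by field_simp
    rw [e1, e2, one_smul, one_smul, hψ₂]
    abel
  have key := hψ.2 (x₁ := ((a + b) / a) • ψ₁) (x₂ := ((a + b) / b) • ψ₂) ?_ ?_ hmem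
  · refine ⟨((a / (a + b) : ℝ) : ℂ), ?_⟩
    have e1 : a / (a + b) * ((a + b) / a) = 1 := by field_simp
    have : ψ₁ = (a / (a + b)) • ψ := by rw [← key, smul_smul, e1, one_smul]
    rw [this]
    ext f
    simp [Complex.real_smul]
  · change ‖((a + b) / a) • ψ₁‖ ≤ 1
    rw [norm_smul, Real.norm_of_nonneg (by positivity)]
    change (a + b) / a * a ≤ 1
    rw [div_mul_cancel₀ _ ha.ne']
    linarith
  · change ‖((a + b) / b) • ψ₂‖ ≤ 1
    rw [norm_smul, Real.norm_of_nonneg (by positivity)]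
    change (a + b) / b * b ≤ 1
    rw [div_mul_cancel₀ _ hb.ne']
    linarith

end Dual

/-! ### Extreme functionals on `C₀(X, ℂ)` are multiples of evaluations -/

section ExtremeFunctional

variable {X : Type*} [TopologicalSpace X]

/-- The functional `f ↦ ψ (u * f)`. -/
noncomputable def mulFunctional (ψ : StrongDual ℂ C₀(X, ℂ)) (u : C₀(X, ℂ)) :
    StrongDual ℂ C₀(X, ℂ) :=
  LinearMap.mkContinuous
    { toFun := fun f => ψ (u * f)
      map_add' := fun f g => by rw [mul_add, map_add]
      map_smul' := fun c f => by rw [mul_smul_comm, map_smul]; rfl } (‖ψ‖ * ‖u‖)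
    (fun f => by
      refine (ψ.le_opNorm _).trans ?_
      rw [mul_assoc]
      gcongr
      exact norm_mul_le _ _)

@[simp]
theorem mulFunctional_apply (ψ : StrongDual ℂ C₀(X, ℂ)) (u f : C₀(X, ℂ)) :
    mulFunctional ψ u f = ψ (u * f) := rfl

theorem exists_norm_one_mul_eq_norm (z : ℂ) : ∃ c : ℂ, ‖c‖ = 1 ∧ c * z = ‖z‖ := by
  by_cases hz : z = 0
  · exact ⟨1, by simp, by simp [hz]⟩
  · have hn : (‖z‖ : ℂ) ≠ 0 := by simpa using hz
    refine ⟨‖z‖ / z, ?_, by field_simp⟩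
    rw [norm_div, Complex.norm_real, norm_norm, div_self (norm_ne_zero_iff.2 hz)]

/-- Unit-ball functions nearly norming the two pieces, rotated to have nonnegative values, combine
pointwise convexly with weights `t` and `1 - t` into one function of the unit ball, on which `ψ` is
nearly the sum of both norms. -/
theorem norm_mulFunctional_add_norm_sub_le (ψ : StrongDual ℂ C₀(X, ℂ)) (u : C₀(X, ℂ))
    (t : X → ℝ) (ht : ∀ x, t x ∈ Set.Icc (0 : ℝ) 1) (hut : ∀ x, u x = t x) :
    ‖mulFunctional ψ u‖ + ‖ψ - mulFunctional ψ u‖ ≤ ‖ψ‖ := by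
  by_contra! h
  set ψ₁ := mulFunctional ψ u with hψ₁
  set ψ₂ := ψ - mulFunctional ψ u with hψ₂
  set d := (‖ψ₁‖ + ‖ψ₂‖ - ‖ψ‖) / 2
  have hd : 0 < d := by simp only [d]; linarith
  obtain ⟨f, hf, hf'⟩ := ψ₁.exists_lt_apply_of_lt_opNorm (r := ‖ψ₁‖ - d) (by linarith)
  obtain ⟨g, hg, hg'⟩ := ψ₂.exists_lt_apply_of_lt_opNorm (r := ‖ψ₂‖ - d) (by linarith)
  obtain ⟨a, ha, ha'⟩ := exists_norm_one_mul_eq_norm (ψ₁ f)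
  obtain ⟨b, hb, hb'⟩ := exists_norm_one_mul_eq_norm (ψ₂ g)
  -- This is `u a f + (1 - u) b g`, expanded because `1 - u` need not vanish at infinity.
  set k : C₀(X, ℂ) := u * (a • f) + (b • g - u * (b • g)) with hk
  have hψk : ψ k = ((‖ψ₁ f‖ + ‖ψ₂ g‖ : ℝ) : ℂ) := by
    push_cast
    rw [← ha', ← hb', hk, hψ₂, hψ₁]
    simp only [_root_.sub_apply, mulFunctional_apply, map_add, map_sub,
      mul_smul_comm, map_smul, smul_eq_mul]
    ring
  have hkn : ‖k‖ ≤ 1 := by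
    refine norm_le_of_forall_apply_le zero_le_one fun x => ?_
    have hx : k x = (t x : ℂ) * (a * f x) + ((1 - t x : ℝ) : ℂ) * (b * g x) := by
      simp only [hk, ZeroAtInftyContinuousMap.add_apply, ZeroAtInftyContinuousMap.sub_apply,
        ZeroAtInftyContinuousMap.mul_apply, ZeroAtInftyContinuousMap.smul_apply, hut, smul_eq_mul]
      push_cast
      ring
    obtain ⟨h0, h1⟩ := ht x
    rw [hx]
    refine (norm_add_le _ _).trans ?_
    rw [norm_mul, norm_mul, norm_mul, norm_mul, ha, hb, Complex.norm_real, Complex.norm_real,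
      Real.norm_of_nonneg h0, Real.norm_of_nonneg (by linarith)]
    have hfx := (norm_apply_le f x).trans hf.le
    have hgx := (norm_apply_le g x).trans hg.le
    nlinarith [norm_nonneg (f x), norm_nonneg (g x)]
  have h1 : ‖ψ k‖ ≤ ‖ψ‖ := (ψ.le_opNorm k).trans (mul_le_of_le_one_right (norm_nonneg _) hkn)
  rw [hψk, Complex.norm_real, Real.norm_of_nonneg (by positivity)] at h1
  simp only [d] at hf' hg'
  linarith

/-- Cutting off splits `ψ` norm-additively, so extremality makes the piece proportional to `ψ`. This
is what localizes `ψ` at one point. -/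
theorem exists_mulFunctional_eq_smul {ψ : StrongDual ℂ C₀(X, ℂ)}
    (hψ : ψ ∈ unitBallExtreme C₀(X, ℂ)) (u : C₀(X, ℂ))
    (t : X → ℝ) (ht : ∀ x, t x ∈ Set.Icc (0 : ℝ) 1) (hut : ∀ x, u x = t x) :
    ∃ c : ℂ, ∀ f, ψ (u * f) = c * ψ f := by
  obtain ⟨c, hc⟩ := exists_eq_smul_of_mem_unitBallExtreme hψ (mulFunctional ψ u)
    (norm_mulFunctional_add_norm_sub_le ψ u t ht hut)
  exact ⟨c, fun f => by rw [← mulFunctional_apply, hc]; rfl⟩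

theorem norm_mul_le_of_forall_mem {u f : C₀(X, ℂ)} {s : Set X} {ε : ℝ} (hε : 0 ≤ ε)
    (hu : ∀ x, ‖u x‖ ≤ 1) (hus : ∀ x ∉ s, u x = 0) (hf : ∀ x ∈ s, ‖f x‖ ≤ ε) : ‖u * f‖ ≤ ε := by
  refine norm_le_of_forall_apply_le hε fun x => ?_
  rw [ZeroAtInftyContinuousMap.mul_apply, norm_mul]
  by_cases hx : x ∈ s
  · calc ‖u x‖ * ‖f x‖ ≤ 1 * ε := by gcongr; exacts [hu x, hf x hx]
      _ = ε := one_mul _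
  · rw [hus x hx]; simpa using hε

variable [T2Space X] [LocallyCompactSpace X]

/-- Every nonzero functional has a point in its support. -/
theorem exists_forall_isOpen_exists_apply_mul_ne_zero {ψ : StrongDual ℂ C₀(X, ℂ)} (hψ : ψ ≠ 0) :
    ∃ x : X, ∀ U : Set X, IsOpen U → x ∈ U → ∃ (u : C(X, ℝ)) (hu : HasCompactSupport u)
      (f : C₀(X, ℂ)), tsupport u ⊆ U ∧ ψ (ofRealCompactSupport u hu * f) ≠ 0 := by
  by_contra! hcon
  choose U hUo hxU hU using hcon
  apply hψ
  ext f
  rw [_root_.zero_apply]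
  refine norm_eq_zero.1 (le_antisymm (le_of_forall_pos_le_add fun ε hε => ?_) (norm_nonneg _))
  rw [zero_add]
  set δ := ε / (‖ψ‖ + 1)
  have hδ : 0 < δ := by positivity
  have hK := isCompact_setOf_le_norm_apply f hδ
  -- The cutoff `v` is `1` where `‖f‖ ≥ δ`, so `v f` is within `δ` of `f`. A partition of unity on
  -- its support splits `v f` into pieces killed by `ψ`.
  obtain ⟨v, hv1, -, hvc, hv01⟩ := exists_continuous_one_zero_of_isCompact hK
    isClosed_empty (Set.disjoint_empty _)
  have hK' : IsCompact (tsupport v) := hvc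
  obtain ⟨s, hs⟩ := hK'.elim_finite_subcover U hUo fun x _ => Set.mem_iUnion.2 ⟨x, hxU x⟩
  let e := s.equivFin.symm
  obtain ⟨u, hus, hu1, -, huc⟩ := exists_continuous_sum_one_of_isOpen_isCompact
    (s := fun i => U (e i)) (fun i => hUo _) hK' (by
      intro x hx
      obtain ⟨y, hy, hxy⟩ := Set.mem_iUnion₂.1 (hs hx)
      exact Set.mem_iUnion.2 ⟨s.equivFin ⟨y, hy⟩, by simpa [e] using hxy⟩)
  set w := ofRealCompactSupport v hvc
  have hw0 : ψ (w * f) = 0 := by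
    have hsum : ∑ i, ofRealCompactSupport (u i) (huc i) * (w * f) = w * f := by
      ext x
      rw [← Finset.sum_mul, ZeroAtInftyContinuousMap.mul_apply]
      by_cases hx : x ∈ tsupport v
      · have h1 := hu1 hx
        rw [Finset.sum_apply] at h1
        have h2 : (∑ i, ofRealCompactSupport (u i) (huc i)) x = 1 := by
          have h3 : (∑ i, ofRealCompactSupport (u i) (huc i)) x =
              ∑ i, ofRealCompactSupport (u i) (huc i) x :=
            map_sum (evalFunctional x) _ _
          simpa [h3] using congrArg (fun a : ℝ => (a : ℂ)) h1
        rw [h2, one_mul]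
      · have : w x = 0 := by simp [w, image_eq_zero_of_notMem_tsupport hx]
        simp [this]
    rw [← hsum, map_sum]
    exact Finset.sum_eq_zero fun i _ => hU (e i) (u i) (huc i) (w * f) (hus i)
  have hfw : ‖f - w * f‖ ≤ δ := by
    refine norm_le_of_forall_apply_le hδ.le fun x => ?_
    have hx : (f - w * f) x = ((1 - v x : ℝ) : ℂ) * f x := by
      simp [w]; ring
    obtain ⟨h0, h1⟩ := hv01 x
    rw [hx, norm_mul, Complex.norm_real, Real.norm_of_nonneg (by linarith)]
    by_cases hxK : δ ≤ ‖f x‖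
    · have : v x = 1 := hv1 hxK
      simp [this, hδ.le]
    · nlinarith [norm_nonneg (f x), not_le.1 hxK]
  have : ψ f = ψ (f - w * f) := by rw [map_sub, hw0, sub_zero]
  rw [this]
  calc ‖ψ (f - w * f)‖ ≤ ‖ψ‖ * ‖f - w * f‖ := ψ.le_opNorm _
    _ ≤ ‖ψ‖ * δ := by gcongr
    _ ≤ (‖ψ‖ + 1) * δ := by gcongr; linarith
    _ = ε := by simp only [δ]; field_simp

theorem exists_compactSupport_eq_one (x : X) {U : Set X} (hU : IsOpen U) (hx : x ∈ U) :
    ∃ (v : C(X, ℝ)) (_ : HasCompactSupport v) (W : Set X), IsOpen W ∧ x ∈ W ∧ W ⊆ U ∧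
      (∀ z ∈ W, v z = 1) ∧ (∀ z ∉ U, v z = 0) ∧ ∀ z, v z ∈ Set.Icc (0 : ℝ) 1 := by
  obtain ⟨K, hK, hxK, hKU⟩ := exists_compact_subset hU hx
  obtain ⟨v, hv1, hv0, hvc, hv01⟩ := exists_continuous_one_zero_of_isCompact hK hU.isClosed_compl
    (Set.disjoint_compl_right_iff_subset.2 hKU)
  exact ⟨v, hvc, interior K, isOpen_interior, hxK, interior_subset.trans hKU,
    fun z hz => hv1 (interior_subset hz), fun z hz => hv0 hz, hv01⟩

/-- Nonzero extreme points of the unit ball of the dual of `C₀(X)` are multiples of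
evaluations. -/
theorem exists_eq_smul_evalFunctional {ψ : StrongDual ℂ C₀(X, ℂ)}
    (hψ : ψ ∈ unitBallExtreme C₀(X, ℂ)) (h0 : ψ ≠ 0) :
    ∃ (x : X) (c : ℂ), ‖c‖ ≤ 1 ∧ ∀ f, ψ f = c * f x := by
  obtain ⟨x, hx⟩ := exists_forall_isOpen_exists_apply_mul_ne_zero h0
  have hker : ∀ g : C₀(X, ℂ), g x = 0 → ψ g = 0 := by
    intro g hg
    refine norm_eq_zero.1 (le_antisymm (le_of_forall_pos_le_add fun ε hε => ?_) (norm_nonneg _))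
    rw [zero_add]
    set U := {z | ‖g z‖ < ε}
    have hUo : IsOpen U := isOpen_lt (map_continuous g).norm continuous_const
    have hxU : x ∈ U := by simpa [U, hg] using hε
    obtain ⟨v, hvc, W, hWo, hxW, -, hv1, hv0, hv01⟩ := exists_compactSupport_eq_one x hUo hxU
    set w := ofRealCompactSupport v hvc with hw
    obtain ⟨c, hc⟩ := exists_mulFunctional_eq_smul hψ w v hv01 fun _ => rfl
    obtain ⟨u, huc, f, huW, hne⟩ := hx W hWo hxW
    have hwf : w * (ofRealCompactSupport u huc * f) = ofRealCompactSupport u huc * f := by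
      ext z
      by_cases hz : z ∈ W
      · simp [hw, hv1 z hz]
      · have : u z = 0 := image_eq_zero_of_notMem_tsupport fun h => hz (huW h)
        simp [this]
    -- `w` is `1` on `W`, and `ψ` does not vanish on some function supported in `W`.
    have hc1 : c = 1 := by
      have := hc (ofRealCompactSupport u huc * f)
      rw [hwf] at this
      exact (mul_eq_right₀ hne).1 this.symm
    have hψg : ψ g = ψ (w * g) := by rw [hc g, hc1, one_mul]
    have hle : ‖w * g‖ ≤ ε := by
      refine norm_mul_le_of_forall_mem (s := U) hε.le (fun z => ?_) (fun z hz => ?_)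
        fun z hz => le_of_lt hz
      · rw [hw, ofRealCompactSupport_apply, Complex.norm_real, Real.norm_of_nonneg (hv01 z).1]
        exact (hv01 z).2
      · simp [hw, hv0 z hz]
    rw [hψg]
    calc ‖ψ (w * g)‖ ≤ ‖ψ‖ * ‖w * g‖ := ψ.le_opNorm _
      _ ≤ 1 * ε := by gcongr; exact hψ.1
      _ = ε := one_mul _
  obtain ⟨v, hvc, W, -, hxW, -, hv1, -, hv01⟩ :=
    exists_compactSupport_eq_one x isOpen_univ (Set.mem_univ x)
  set w := ofRealCompactSupport v hvc with hw
  have hwx : w x = 1 := by simp [hw, hv1 x hxW]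
  refine ⟨x, ψ w, ?_, fun f => ?_⟩
  · have hwn : ‖w‖ ≤ 1 := norm_le_of_forall_apply_le zero_le_one fun z => by
      rw [hw, ofRealCompactSupport_apply, Complex.norm_real, Real.norm_of_nonneg (hv01 z).1]
      exact (hv01 z).2
    exact (ψ.le_opNorm w).trans (mul_le_one₀ hψ.1 (norm_nonneg _) hwn)
  · have := hker (f - f x • w) (by simp [hwx])
    rw [map_sub, map_smul, sub_eq_zero, smul_eq_mul] at this
    rw [this, mul_comm]

end ExtremeFunctional

/-! ### Extending extreme functionals from a subspace -/

section Restriction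

variable {V : Type*} [NormedAddCommGroup V] [NormedSpace ℂ V]

theorem mem_dual_closedBall_iff {χ : StrongDual ℂ V} :
    χ ∈ Metric.closedBall (0 : StrongDual ℂ V) 1 ↔ ‖χ‖ ≤ 1 :=
  mem_closedBall_zero_iff

theorem unitBallExtreme_eq :
    unitBallExtreme V = Set.extremePoints ℝ (Metric.closedBall (0 : StrongDual ℂ V) 1) := by
  refine congrArg (Set.extremePoints ℝ) (Set.ext fun χ => ?_)
  exact (mem_dual_closedBall_iff (V := V)).symm

/-- Restriction of functionals to a subspace, as a weak-* continuous affine map. -/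
noncomputable def weakRestrict (E : Submodule ℂ V) : WeakDual ℂ V →ᴬ[ℝ] WeakDual ℂ E where
  toFun ψ := StrongDual.toWeakDual (restrict E (WeakDual.toStrongDual ψ))
  linear :=
    { toFun := fun ψ => StrongDual.toWeakDual (restrict E (WeakDual.toStrongDual ψ))
      map_add' := fun _ _ => rfl
      map_smul' := fun _ _ => rfl }
  map_vadd' := fun _ _ => rfl
  cont := WeakDual.continuous_of_continuous_eval fun x => WeakDual.eval_continuous (x : V)

theorem norm_restrict_le (E : Submodule ℂ V) (e : StrongDual ℂ V) : ‖restrict E e‖ ≤ ‖e‖ :=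
  ContinuousLinearMap.opNorm_le_bound _ (norm_nonneg _) fun x => e.le_opNorm (x : V)

/-- Every extreme point of the dual ball of a subspace extends to an extreme point of the dual
ball of the whole space. -/
theorem exists_mem_unitBallExtreme_restrict_eq (E : Submodule ℂ V) {ψ : StrongDual ℂ E}
    (hψ : ψ ∈ unitBallExtreme E) : ∃ χ ∈ unitBallExtreme V, restrict E χ = ψ := by
  have hs : IsCompact (WeakDual.toStrongDual ⁻¹' Metric.closedBall (0 : StrongDual ℂ V) 1) :=
    WeakDual.isCompact_closedBall 0 1
  have himg : weakRestrict E '' (WeakDual.toStrongDual ⁻¹'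
      Metric.closedBall (0 : StrongDual ℂ V) 1) =
      (WeakDual.toStrongDual ⁻¹' Metric.closedBall (0 : StrongDual ℂ E) 1) := by
    ext χ
    constructor
    · rintro ⟨e, he, rfl⟩
      have he' : ‖WeakDual.toStrongDual e‖ ≤ 1 := mem_dual_closedBall_iff.1 he
      have := (norm_restrict_le E (WeakDual.toStrongDual e)).trans he'
      exact mem_dual_closedBall_iff.2 this
    · intro hχ
      obtain ⟨g, hg, hgn⟩ := exists_extension_norm_eq E (WeakDual.toStrongDual χ)
      refine ⟨StrongDual.toWeakDual g, ?_, ?_⟩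
      · have : ‖WeakDual.toStrongDual χ‖ ≤ 1 := mem_dual_closedBall_iff.1 hχ
        have : ‖g‖ ≤ 1 := hgn.trans_le this
        exact mem_dual_closedBall_iff.2 this
      · refine DFunLike.ext _ _ fun x => ?_
        exact hg x
  have : LocallyConvexSpace ℝ (WeakDual ℂ V) :=
    inferInstanceAs (LocallyConvexSpace ℝ (WeakBilin (topDualPairing ℂ V)))
  have := surjOn_extremePoints_image (weakRestrict E) hs
  rw [himg] at this
  rw [unitBallExtreme_eq] at hψ
  obtain ⟨e, he, heψ⟩ := this hψ
  refine ⟨WeakDual.toStrongDual e, ?_, ?_⟩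
  · rw [unitBallExtreme_eq]; exact he
  · exact heψ

end Restriction

/-! ### Boundary property of the Choquet boundary -/

section ChoquetBoundary

theorem left_eq_of_mem_openSegment_of_norm_le {w u v : ℂ} (hu : ‖u‖ ≤ ‖w‖) (hv : ‖v‖ ≤ ‖w‖)
    (hw : w ∈ openSegment ℝ u v) : u = w := by
  by_cases h0 : w = 0
  · rw [h0, norm_zero] at hu
    rw [h0, norm_le_zero_iff.1 hu]
  · have := StrictConvexSpace.sphere_subset_extremePoints_closedBall (0 : ℂ) (r := ‖w‖)
      (norm_ne_zero_iff.2 h0) (mem_sphere_zero_iff_norm.2 rfl)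
    exact this.2 (mem_closedBall_zero_iff.2 hu) (mem_closedBall_zero_iff.2 hv) hw

variable {V : Type*} [NormedAddCommGroup V] [NormedSpace ℂ V]

/-- The functionals in the dual ball which take norm-attaining values of `e` whenever `e` attains
its norm contain an extreme point of the ball. -/
theorem exists_mem_unitBallExtreme_forall_eq {e : StrongDual ℂ V} (he : ‖e‖ ≤ 1) :
    ∃ ψ ∈ unitBallExtreme V, ∀ F : V, ‖e F‖ = ‖F‖ → ψ F = e F := by
  set s : Set (WeakDual ℂ V) := (WeakDual.toStrongDual ⁻¹' Metric.closedBall (0 : StrongDual ℂ V) 1)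
    ∩ {ψ | ∀ F : V, ‖e F‖ = ‖F‖ → ψ F = e F} with hs
  have hclosed : IsClosed {ψ : WeakDual ℂ V | ∀ F : V, ‖e F‖ = ‖F‖ → ψ F = e F} := by
    simp only [Set.ofPred_forall]
    exact isClosed_iInter fun F => isClosed_iInter fun _ =>
      isClosed_eq (WeakDual.eval_continuous F) continuous_const
  have hcomp : IsCompact s := (WeakDual.isCompact_closedBall 0 1).inter_right hclosed
  have : LocallyConvexSpace ℝ (WeakDual ℂ V) :=
    inferInstanceAs (LocallyConvexSpace ℝ (WeakBilin (topDualPairing ℂ V)))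
  obtain ⟨ψ, hψ⟩ := hcomp.extremePoints_nonempty
    ⟨StrongDual.toWeakDual e, mem_dual_closedBall_iff.2 he, fun _ _ => rfl⟩
  refine ⟨WeakDual.toStrongDual ψ, ?_, hψ.1.2⟩
  rw [unitBallExtreme_eq]
  refine ⟨hψ.1.1, fun ψ₁ h₁ ψ₂ h₂ hmem => ?_⟩
  -- `s` is a face of the ball: both ends of a segment through `ψ` take values of modulus at most
  -- `‖F‖ = ‖e F‖`, so strict convexity of the disc forces them to equal `e F`.
  have key : ∀ (χ₁ χ₂ : StrongDual ℂ V), ‖χ₁‖ ≤ 1 → ‖χ₂‖ ≤ 1 →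
      WeakDual.toStrongDual ψ ∈ openSegment ℝ χ₁ χ₂ → ∀ F : V, ‖e F‖ = ‖F‖ → χ₁ F = e F := by
    rintro χ₁ χ₂ h₁ h₂ ⟨a, b, ha, hb, hab, h⟩ F hF
    have hle : ∀ χ : StrongDual ℂ V, ‖χ‖ ≤ 1 → ‖χ F‖ ≤ ‖e F‖ := fun χ hχ => by
      rw [hF]
      exact (χ.le_opNorm F).trans (mul_le_of_le_one_left (norm_nonneg _) hχ)
    refine left_eq_of_mem_openSegment_of_norm_le (hle χ₁ h₁) (hle χ₂ h₂) ⟨a, b, ha, hb, hab, ?_⟩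
    rw [← hψ.1.2 F hF]
    exact congrArg (fun χ : StrongDual ℂ V => χ F) h
  have h₁' := mem_dual_closedBall_iff.1 h₁
  have h₂' := mem_dual_closedBall_iff.1 h₂
  exact hψ.2 (x₁ := StrongDual.toWeakDual ψ₁) ⟨h₁, key ψ₁ ψ₂ h₁' h₂' hmem⟩
    (x₂ := StrongDual.toWeakDual ψ₂)
    ⟨h₂, key ψ₂ ψ₁ h₂' h₁' (by rwa [openSegment_symm])⟩ hmem

theorem smul_mem_unitBallExtreme {ψ : StrongDual ℂ V} (hψ : ψ ∈ unitBallExtreme V) {c : ℂ}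
    (hc : ‖c‖ = 1) : c • ψ ∈ unitBallExtreme V := by
  have hc0 : c ≠ 0 := norm_ne_zero_iff.1 (by rw [hc]; exact one_ne_zero)
  have hn : ∀ (d : ℂ) (χ : StrongDual ℂ V), ‖d‖ = 1 → ‖χ‖ ≤ 1 → ‖d • χ‖ ≤ 1 := fun d χ hd hχ => by
    rwa [norm_smul, hd, one_mul]
  have hc' : ‖c⁻¹‖ = 1 := by rw [norm_inv, hc, inv_one]
  refine ⟨hn c ψ hc hψ.1, fun ψ₁ h₁ ψ₂ h₂ => ?_⟩
  rintro ⟨a, b, ha, hb, hab, h⟩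
  have := hψ.2 (hn c⁻¹ ψ₁ hc' h₁) (hn c⁻¹ ψ₂ hc' h₂) ⟨a, b, ha, hb, hab, by
    change a • (c⁻¹ • ψ₁) + b • (c⁻¹ • ψ₂) = ψ
    rw [smul_comm a, smul_comm b]
    exact (smul_add c⁻¹ (a • ψ₁) (b • ψ₂)).symm.trans (by rw [h, inv_smul_smul₀ hc0])⟩
  rw [← this, smul_inv_smul₀ hc0]

variable {X : Type*} [TopologicalSpace X] [T2Space X] [LocallyCompactSpace X]

/-- The Choquet boundary meets every set of common maximum-modulus points of functions
in `E`. -/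
theorem exists_mem_choquetBoundary (E : Submodule ℂ C₀(X, ℂ)) (x₀ : X) {F₀ : C₀(X, ℂ)}
    (hF₀ : F₀ ∈ E) (hne : F₀ ≠ 0) (hx₀ : ‖F₀ x₀‖ = ‖F₀‖) :
    ∃ z ∈ choquetBoundary E, ∀ F ∈ E, ‖F x₀‖ = ‖F‖ → ‖F z‖ = ‖F‖ := by
  have hev : ‖restrict E (evalFunctional x₀)‖ ≤ 1 :=
    ContinuousLinearMap.opNorm_le_bound _ zero_le_one fun f => by
      rw [one_mul]; exact norm_apply_le (f : C₀(X, ℂ)) x₀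
  obtain ⟨ψ, hψ, hψe⟩ := exists_mem_unitBallExtreme_forall_eq hev
  obtain ⟨χ, hχ, hχψ⟩ := exists_mem_unitBallExtreme_restrict_eq E hψ
  have hval : ∀ F ∈ E, ‖F x₀‖ = ‖F‖ → χ F = F x₀ := by
    intro F hF h
    have : restrict E χ ⟨F, hF⟩ = ψ ⟨F, hF⟩ := by rw [hχψ]
    exact this.trans (hψe ⟨F, hF⟩ h)
  have hχ0 : χ ≠ 0 := by
    rintro rfl
    have h1 : (0 : ℂ) = F₀ x₀ := hval F₀ hF₀ hx₀
    rw [← h1, norm_zero] at hx₀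
    exact hne (norm_eq_zero.1 hx₀.symm)
  obtain ⟨z, c, hc, hcz⟩ := exists_eq_smul_evalFunctional hχ hχ0
  have hge : ∀ F ∈ E, ‖F x₀‖ = ‖F‖ → ‖F‖ = ‖c‖ * ‖F z‖ := by
    intro F hF h
    rw [← norm_mul, ← hcz, hval F hF h, h]
  have hpos : 0 < ‖F₀‖ := norm_pos_iff.2 hne
  -- `‖F₀‖ = ‖c‖ * ‖F₀ z‖ ≤ ‖c‖ * ‖F₀‖` with `F₀ ≠ 0`.
  have hc1 : ‖c‖ = 1 := by
    refine le_antisymm hc ?_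
    have h1 := hge F₀ hF₀ hx₀
    have h2 := norm_apply_le F₀ z
    nlinarith [norm_nonneg c]
  refine ⟨z, ?_, fun F hF h => by rw [hge F hF h, hc1, one_mul]⟩
  have hc0 : c ≠ 0 := norm_ne_zero_iff.1 (by rw [hc1]; exact one_ne_zero)
  have heq : restrict E (evalFunctional z) = c⁻¹ • ψ := by
    rw [← hχψ]
    ext F
    change (F : C₀(X, ℂ)) z = c⁻¹ * χ F
    rw [hcz, inv_mul_cancel_left₀ hc0]
  change restrict E (evalFunctional z) ∈ unitBallExtreme E
  rw [heq]
  exact smul_mem_unitBallExtreme hψ (by rw [norm_inv, hc1, inv_one])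

/-- The boundary property of the Choquet boundary, for sets of functions whose moduli are moduli
of functions in `E`. -/
theorem exists_mem_choquetBoundary_of_absSet_subset {A : Set C₀(X, ℂ)} {E : Submodule ℂ C₀(X, ℂ)}
    (hA : absSet A ⊆ absSet (E : Set C₀(X, ℂ))) (x₀ : X) {f₀ : C₀(X, ℂ)} (hf₀ : f₀ ∈ A)
    (hne : f₀ ≠ 0) (hx₀ : ‖f₀ x₀‖ = ‖f₀‖) :
    ∃ z ∈ choquetBoundary E, ∀ f ∈ A, ‖f x₀‖ = ‖f‖ → ‖f z‖ = ‖f‖ := by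
  have hlift : ∀ f ∈ A, ∃ F ∈ E, (∀ x, ‖F x‖ = ‖f x‖) ∧ ‖F‖ = ‖f‖ := by
    intro f hf
    obtain ⟨F, hF, hFf⟩ := hA ⟨f, hf, rfl⟩
    have h : ∀ x, ‖F x‖ = ‖f x‖ := fun x => congrFun hFf x
    exact ⟨F, hF, h, norm_eq_of_norm_apply_eq h⟩
  obtain ⟨F₀, hF₀, h₀, hn₀⟩ := hlift f₀ hf₀
  obtain ⟨z, hz, hzE⟩ := exists_mem_choquetBoundary E x₀ hF₀
    (norm_pos_iff.1 (by rw [hn₀]; exact norm_pos_iff.2 hne)) (by rw [h₀, hn₀, hx₀])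
  refine ⟨z, hz, fun f hf h => ?_⟩
  obtain ⟨F, hF, hFf, hFn⟩ := hlift f hf
  rw [← hFf, ← hFn]
  exact hzE F hF (by rw [hFf, hFn, h])

end ChoquetBoundary

/-- The standing assumptions on `φ`. -/
structure IsGauge (φ : ℂ × ℂ → ℝ) : Prop where
  nonneg : ∀ p, 0 ≤ φ p
  continuous : Continuous φ
  inc : Inc φ
  con : Con φ

/-! ### Growth, convexity and localization estimates for `φ` -/

namespace IsGauge

variable {φ : ℂ × ℂ → ℝ}

/-- Lets each estimate for `φ(f, g)` serve for `φ(g, f)` as well. -/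
theorem swap (h : IsGauge φ) : IsGauge (φ ∘ Prod.swap) where
  nonneg _ := h.nonneg _
  continuous := h.continuous.comp continuous_swap
  inc := ⟨fun s₁ s₂ hs t => (h.inc.1 s₁ s₂ hs t).symm, fun s₁ s₂ hs t ht =>
    (h.inc.2 s₁ s₂ hs t ht).symm⟩
  con n hn s t := (h.con n hn s t).symm

theorem mono (h : IsGauge φ) {s s' t t' : ℂ} (hs : ‖s‖ ≤ ‖s'‖) (ht : ‖t‖ ≤ ‖t'‖) :
    φ (s, t) ≤ φ (s', t') :=
  ((h.inc.1 s s' hs t).1).trans (h.inc.1 t t' ht s').2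

theorem midpoint_left_le (h : IsGauge φ) (s s' t : ℂ) :
    φ ((s + s') / 2, t) ≤ (φ (s, t) + φ (s', t)) / 2 := by
  have := (h.con 2 two_pos ![s, s'] t).1
  simp only [Fin.sum_univ_two, Matrix.cons_val_zero, Matrix.cons_val_one] at this
  have e : (s + s') / 2 = 1 / ((2 : ℕ) : ℂ) * (s + s') := by push_cast; ring
  rw [e]
  refine this.trans (le_of_eq ?_)
  push_cast
  ring

/-- Midpoint convexity with one endpoint `0` at least doubles the increment of `φ(·, t)` over `φ(0,
t)` whenever the argument doubles, and the increment at `1` is positive. -/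
theorem exists_lt_of_pos (h : IsGauge φ) {t : ℂ} (ht : t ≠ 0) (M : ℝ) :
    ∃ R₀ : ℝ, ∀ R : ℝ, R₀ ≤ R → M < φ ((R : ℂ), t) := by
  set d := φ ((1 : ℝ), t) - φ (0, t) with hd
  have hd0 : 0 < d := sub_pos.2 (h.inc.2 0 ((1 : ℝ) : ℂ) (by simp) t ht).1
  have hpow : ∀ n : ℕ, (2 : ℝ) ^ n * d ≤ φ (((2 ^ n : ℝ) : ℂ), t) - φ (0, t) := by
    intro n
    induction n with
    | zero => simp [hd]
    | succ n ih =>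
      have := h.midpoint_left_le ((2 ^ (n + 1) : ℝ) : ℂ) 0 t
      have e : (((2 ^ (n + 1) : ℝ) : ℂ) + 0) / 2 = ((2 ^ n : ℝ) : ℂ) := by
        push_cast; ring
      rw [e] at this
      have e' : (2 : ℝ) ^ (n + 1) * d = 2 * (2 ^ n * d) := by ring
      linarith
  obtain ⟨n, hn⟩ := pow_unbounded_of_one_lt ((M + 1) / d) one_lt_two
  refine ⟨2 ^ n, fun R hR => ?_⟩
  have h1 : M + 1 < 2 ^ n * d := (div_lt_iff₀ hd0).1 hn
  have h2 : φ (((2 ^ n : ℝ) : ℂ), t) ≤ φ ((R : ℂ), t) := by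
    refine h.mono ?_ le_rfl
    have : (0 : ℝ) < 2 ^ n := by positivity
    rw [Complex.norm_real, Complex.norm_real, Real.norm_of_nonneg this.le,
      Real.norm_of_nonneg (this.le.trans hR)]
    exact hR
  have := hpow n
  have := h.nonneg (0, t)
  linarith

theorem diag_lt (h : IsGauge φ) {a b : ℝ} (ha : 0 ≤ a) (hab : a < b) :
    φ ((a : ℂ), (a : ℂ)) < φ ((b : ℂ), (b : ℂ)) := by
  have hb : (b : ℂ) ≠ 0 := by exact_mod_cast (ha.trans_lt hab).ne'
  have hn : ‖(a : ℂ)‖ < ‖(b : ℂ)‖ := by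
    rwa [Complex.norm_real, Complex.norm_real, Real.norm_of_nonneg ha,
      Real.norm_of_nonneg (ha.trans hab.le)]
  exact ((h.inc.1 _ _ hn.le _).2).trans_lt (h.inc.2 _ _ hn _ hb).1

variable {X : Type*} [TopologicalSpace X]

theorem le_normPhi (h : IsGauge φ) (f g : C₀(X, ℂ)) (x : X) : φ (f x, g x) ≤ normPhi φ f g :=
  (le_abs_self _).trans (le_ciSup (bddAbove_normPhi h.continuous f g) x)

theorem normPhi_le (h : IsGauge φ) {f g : C₀(X, ℂ)} {a : ℝ} (ha : 0 ≤ a)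
    (hfg : ∀ x, φ (f x, g x) ≤ a) : normPhi φ f g ≤ a :=
  Real.iSup_le (fun x => by rw [Real.norm_of_nonneg (h.nonneg _)]; exact hfg x) ha

theorem normPhi_le_of_norm_le (h : IsGauge φ) {f g : C₀(X, ℂ)} {a b : ℝ} (hf : ‖f‖ ≤ a)
    (hg : ‖g‖ ≤ b) : normPhi φ f g ≤ φ ((a : ℂ), (b : ℂ)) := by
  refine h.normPhi_le (h.nonneg _) fun x => h.mono ?_ ?_
  · rw [Complex.norm_real]
    exact ((norm_apply_le f x).trans hf).trans (le_abs_self a)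
  · rw [Complex.norm_real]
    exact ((norm_apply_le g x).trans hg).trans (le_abs_self b)

theorem le_normPhi_of_le_norm_apply (h : IsGauge φ) {f g : C₀(X, ℂ)} {a b : ℝ} {x : X}
    (ha : 0 ≤ a) (hb : 0 ≤ b) (hf : a ≤ ‖f x‖) (hg : b ≤ ‖g x‖) :
    φ ((a : ℂ), (b : ℂ)) ≤ normPhi φ f g := by
  refine (h.mono ?_ ?_).trans (h.le_normPhi f g x)
  · rwa [Complex.norm_real, Real.norm_of_nonneg ha]
  · rwa [Complex.norm_real, Real.norm_of_nonneg hb]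

theorem normPhi_congr (h : IsGauge φ) {f f' g : C₀(X, ℂ)} (hf : ∀ x, ‖f x‖ = ‖f' x‖) :
    normPhi φ f g = normPhi φ f' g := by
  unfold normPhi
  congr 1
  ext x
  rw [le_antisymm (h.mono (hf x).le le_rfl : φ (f x, g x) ≤ φ (f' x, g x))
    (h.mono (hf x).ge le_rfl)]

theorem normPhi_midpoint_le (h : IsGauge φ) (f f' g : C₀(X, ℂ)) :
    normPhi φ ((1 / 2 : ℂ) • (f + f')) g ≤ (normPhi φ f g + normPhi φ f' g) / 2 := by
  have hn : ∀ f : C₀(X, ℂ), 0 ≤ normPhi φ f g := fun f => Real.iSup_nonneg fun _ => norm_nonneg _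
  refine h.normPhi_le (by linarith [hn f, hn f']) fun x => ?_
  have e : ((1 / 2 : ℂ) • (f + f')) x = (f x + f' x) / 2 := by
    simp; ring
  rw [e]
  linarith [h.midpoint_left_le (f x) (f' x) (g x), h.le_normPhi f g x, h.le_normPhi f' g x]

/-- If `f` is small on `V` and `g` is small off `V`, then `‖φ(f, g)‖` is small. -/
theorem normPhi_lt_of_small (h : IsGauge φ) {f g : C₀(X, ℂ)} {V : Set X} {a s R ε : ℝ}
    (ha : 0 ≤ a) (has : a < s) (hR : 0 < R) (hε : 0 ≤ ε) (hfV : ∀ z ∈ V, ‖f z‖ ≤ a)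
    (hg : ‖g‖ ≤ R) (hgV : ∀ z ∉ V, ‖g z‖ ≤ ε)
    (hlt : φ ((‖f‖ : ℂ), (ε : ℂ)) < φ ((s : ℂ), (R : ℂ))) :
    normPhi φ f g < φ ((s : ℂ), (R : ℂ)) := by
  have h1 : φ ((a : ℂ), (R : ℂ)) < φ ((s : ℂ), (R : ℂ)) := by
    refine (h.inc.2 _ _ ?_ _ (by exact_mod_cast hR.ne')).1
    rwa [Complex.norm_real, Complex.norm_real, Real.norm_of_nonneg ha,
      Real.norm_of_nonneg (ha.trans has.le)]
  -- The supremum need not be attained, so strictness requires one bound on `V` and one off `V`,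
  -- both below the target.
  refine (h.normPhi_le (a := max (φ ((a : ℂ), (R : ℂ))) (φ ((‖f‖ : ℂ), (ε : ℂ))))
    ((h.nonneg _).trans (le_max_left _ _)) fun z => ?_).trans_lt (max_lt h1 hlt)
  by_cases hz : z ∈ V
  · refine le_trans (h.mono ?_ ?_) (le_max_left _ _)
    · rw [Complex.norm_real, Real.norm_of_nonneg ha]; exact hfV z hz
    · rw [Complex.norm_real, Real.norm_of_nonneg hR.le]; exact (norm_apply_le g z).trans hg
  · refine le_trans (h.mono ?_ ?_) (le_max_right _ _)
    · rw [Complex.norm_real, norm_norm]; exact norm_apply_le f z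
    · rw [Complex.norm_real, Real.norm_of_nonneg hε]; exact hgV z hz

theorem eventually_lt (h : IsGauge φ) {a s R : ℝ}
    (hlt : φ ((a : ℂ), 0) < φ ((s : ℂ), (R : ℂ))) :
    ∀ᶠ ε : ℝ in 𝓝[>] 0, φ ((a : ℂ), ((R * ε : ℝ) : ℂ)) < φ ((s : ℂ), (R : ℂ)) := by
  have hc : Continuous fun ε : ℝ => φ ((a : ℂ), ((R * ε : ℝ) : ℂ)) :=
    h.continuous.comp (continuous_const.prodMk
      (Complex.continuous_ofReal.comp (continuous_const.mul continuous_id)))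
  refine (hc.tendsto 0).eventually_lt_const ?_ |>.filter_mono nhdsWithin_le_nhds
  simpa using hlt

end IsGauge

/-- The properties shared by addition and maximum used to combine `‖φ(f, g)‖` and
`‖φ(g, f)‖`. -/
structure IsCombination (c : ℝ → ℝ → ℝ) : Prop where
  mono : ∀ {a a' b b' : ℝ}, a ≤ a' → b ≤ b' → c a b ≤ c a' b'
  strictMono : ∀ {a a' b b' : ℝ}, a < a' → b < b' → c a b < c a' b'
  midpoint_le : ∀ a a' b b' : ℝ, c ((a + a') / 2) ((b + b') / 2) ≤ (c a b + c a' b') / 2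

theorem isCombination_add : IsCombination fun a b => a + b where
  mono := add_le_add
  strictMono := add_lt_add
  midpoint_le a a' b b' := by linarith

theorem isCombination_max : IsCombination (max : ℝ → ℝ → ℝ) where
  mono := max_le_max
  strictMono := max_lt_max
  midpoint_le a a' b b' := by
    have h1 := le_max_left a b
    have h2 := le_max_right a b
    have h3 := le_max_left a' b'
    have h4 := le_max_right a' b'
    exact max_le (by linarith) (by linarith)

/-! ### Testing functions against peakers -/

section Rho

variable {X : Type*} [TopologicalSpace X]

/-- The combination of `‖φ(f, g)‖` and `‖φ(g, f)‖` by means of `c`. -/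
noncomputable def rho (c : ℝ → ℝ → ℝ) (φ : ℂ × ℂ → ℝ) (f g : C₀(X, ℂ)) : ℝ :=
  c (normPhi φ f g) (normPhi φ g f)

/-- The value of `rho` at constant moduli. -/
noncomputable def rhoConst (c : ℝ → ℝ → ℝ) (φ : ℂ × ℂ → ℝ) (a b : ℝ) : ℝ :=
  c (φ ((a : ℂ), (b : ℂ))) (φ ((b : ℂ), (a : ℂ)))

variable {c : ℝ → ℝ → ℝ} {φ : ℂ × ℂ → ℝ}

theorem rho_le_rhoConst (hc : IsCombination c) (h : IsGauge φ) {f g : C₀(X, ℂ)} {a b : ℝ}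
    (hf : ‖f‖ ≤ a) (hg : ‖g‖ ≤ b) : rho c φ f g ≤ rhoConst c φ a b :=
  hc.mono (h.normPhi_le_of_norm_le hf hg) (h.normPhi_le_of_norm_le hg hf)

theorem rhoConst_le_rho (hc : IsCombination c) (h : IsGauge φ) {f g : C₀(X, ℂ)} {a b : ℝ} {x : X}
    (ha : 0 ≤ a) (hb : 0 ≤ b) (hf : a ≤ ‖f x‖) (hg : b ≤ ‖g x‖) :
    rhoConst c φ a b ≤ rho c φ f g :=
  hc.mono (h.le_normPhi_of_le_norm_apply ha hb hf hg) (h.le_normPhi_of_le_norm_apply hb ha hg hf)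

theorem rho_congr (h : IsGauge φ) {f f' g : C₀(X, ℂ)} (hf : ∀ x, ‖f x‖ = ‖f' x‖) :
    rho c φ f g = rho c φ f' g := by
  unfold rho
  rw [h.normPhi_congr hf]
  congr 1
  exact h.swap.normPhi_congr hf

theorem rho_midpoint_le (hc : IsCombination c) (h : IsGauge φ) (f f' g : C₀(X, ℂ)) :
    rho c φ ((1 / 2 : ℂ) • (f + f')) g ≤ (rho c φ f g + rho c φ f' g) / 2 :=
  (hc.mono (h.normPhi_midpoint_le f f' g) (h.swap.normPhi_midpoint_le f f' g)).trans
    (hc.midpoint_le _ _ _ _)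

/-- `k ∈ A` takes its norm `R` as value at `x`. -/
def IsPeaker (A : Set C₀(X, ℂ)) (R : ℝ) (x : X) (k : C₀(X, ℂ)) : Prop :=
  k ∈ A ∧ k x = R ∧ ‖k‖ = R

/-- The closure properties of subspaces and positive cones, together with the fact that the
strong boundary meets all sets of common maximum-modulus points. -/
structure IsBoundaryCone (A : Set C₀(X, ℂ)) : Prop where
  add_mem : ∀ {f g}, f ∈ A → g ∈ A → f + g ∈ A
  smul_mem : ∀ {f} {r : ℝ}, 0 ≤ r → f ∈ A → (r : ℂ) • f ∈ A
  exists_rotation : ∀ {f}, f ∈ A → ∀ x, ∃ g ∈ A, (∀ z, ‖g z‖ = ‖f z‖) ∧ g x = ‖f x‖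
  exists_boundary : ∀ {f₀}, f₀ ∈ A → f₀ ≠ 0 → ∀ x₀, ‖f₀ x₀‖ = ‖f₀‖ →
    ∃ z ∈ strongBoundary A, ∀ f ∈ A, ‖f x₀‖ = ‖f‖ → ‖f z‖ = ‖f‖

namespace IsBoundaryCone

variable {A : Set C₀(X, ℂ)} (hA : IsBoundaryCone A)
include hA

theorem exists_isPeaker {x : X} (hx : x ∈ strongBoundary A) {R ε : ℝ} (hR : 0 < R) (hε : 0 < ε)
    {V : Set X} (hV : V ∈ 𝓝 x) : ∃ k, IsPeaker A R x k ∧ ∀ z ∉ V, ‖k z‖ < R * ε := by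
  obtain ⟨k, hk, hkx, hkn, hkV⟩ := hx ε hε V hV
  refine ⟨(R : ℂ) • k, ⟨hA.smul_mem hR.le hk, by simp [hkx], ?_⟩, fun z hz => ?_⟩
  · rw [norm_smul, hkn, Complex.norm_real, Real.norm_of_nonneg hR.le, mul_one]
  · rw [ZeroAtInftyContinuousMap.smul_apply, norm_smul, Complex.norm_real,
      Real.norm_of_nonneg hR.le]
    exact mul_lt_mul_of_pos_left (hkV z hz) hR

theorem exists_isPeaker_rotation {f : C₀(X, ℂ)} (hf : f ∈ A) {x : X} {r : ℝ} (hfx : ‖f x‖ = r)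
    (hfn : ‖f‖ = r) : ∃ g, IsPeaker A r x g ∧ ∀ z, ‖g z‖ = ‖f z‖ := by
  obtain ⟨g, hg, hgf, hgx⟩ := hA.exists_rotation hf x
  exact ⟨g, ⟨hg, by rw [hgx, hfx], by rw [norm_eq_of_norm_apply_eq hgf, hfn]⟩, hgf⟩

/-- On a neighbourhood where `f` stays below some `a < s`, strict monotonicity wins; outside it the
peaker is tiny, and `h₁`, `h₂` together with continuity of `φ` at `0` keep both values below the
target. -/
theorem exists_rho_lt (hc : IsCombination c) (h : IsGauge φ) {x : X} (hx : x ∈ strongBoundary A)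
    {f : C₀(X, ℂ)} {s R : ℝ} (hfx : ‖f x‖ < s) (hR : 0 < R)
    (h₁ : φ ((‖f‖ : ℂ), 0) < φ ((s : ℂ), (R : ℂ)))
    (h₂ : φ (0, (‖f‖ : ℂ)) < φ ((R : ℂ), (s : ℂ))) :
    ∃ k, IsPeaker A R x k ∧ rho c φ f k < rhoConst c φ s R := by
  obtain ⟨a, hfa, has⟩ := exists_between hfx
  have ha : 0 ≤ a := (norm_nonneg _).trans hfa.le
  have hV : {z | ‖f z‖ < a} ∈ 𝓝 x :=
    (isOpen_lt (map_continuous f).norm continuous_const).mem_nhds hfa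
  obtain ⟨ε, ⟨hε₁, hε₂⟩, hε⟩ := ((h.eventually_lt h₁).and (h.swap.eventually_lt h₂)).and
    self_mem_nhdsWithin |>.exists
  have hε : 0 < ε := hε
  obtain ⟨k, hk, hkV⟩ := hA.exists_isPeaker hx hR hε hV
  refine ⟨k, hk, hc.strictMono ?_ ?_⟩
  · exact h.normPhi_lt_of_small ha has hR (by positivity) (fun z hz => le_of_lt hz) hk.2.2.le
      (fun z hz => (hkV z hz).le) hε₁
  · exact h.swap.normPhi_lt_of_small ha has hR (by positivity) (fun z hz => le_of_lt hz)
      hk.2.2.le (fun z hz => (hkV z hz).le) hε₂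

/-- Unbounded growth of `φ` in either variable secures the two inequalities required by
`exists_rho_lt` once `R` is large. -/
theorem exists_large_rho_lt (hc : IsCombination c) (h : IsGauge φ) {x : X}
    (hx : x ∈ strongBoundary A) {f : C₀(X, ℂ)} {s : ℝ} (hfx : ‖f x‖ < s) :
    ∃ R > 0, ∃ k, IsPeaker A R x k ∧ rho c φ f k < rhoConst c φ s R := by
  have hs : (s : ℂ) ≠ 0 := by exact_mod_cast ((norm_nonneg _).trans_lt hfx).ne'
  obtain ⟨R₁, h₁⟩ := h.swap.exists_lt_of_pos hs (φ ((‖f‖ : ℂ), 0))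
  obtain ⟨R₂, h₂⟩ := h.exists_lt_of_pos hs (φ (0, (‖f‖ : ℂ)))
  refine ⟨max 1 (max R₁ R₂), by positivity, ?_⟩
  exact hA.exists_rho_lt hc h hx hfx (by positivity)
    (h₁ _ ((le_max_left _ _).trans (le_max_right _ _)))
    (h₂ _ ((le_max_right _ _).trans (le_max_right _ _)))

end IsBoundaryCone

end Rho

/-! ### From `rho`-preserving correspondences to boundary homeomorphisms -/

section Correspondence

/-- A correspondence between `A` and `B`, total on both sides, which preserves `rho`. -/
structure IsRhoCorrespondence {X Y : Type*} [TopologicalSpace X] [TopologicalSpace Y]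
    (c : ℝ → ℝ → ℝ) (φ : ℂ × ℂ → ℝ) (A : Set C₀(X, ℂ)) (B : Set C₀(Y, ℂ))
    (S : C₀(X, ℂ) → C₀(Y, ℂ) → Prop) : Prop where
  combination : IsCombination c
  gauge : IsGauge φ
  left_cone : IsBoundaryCone A
  right_cone : IsBoundaryCone B
  left_mem : ∀ {f g}, S f g → f ∈ A
  right_mem : ∀ {f g}, S f g → g ∈ B
  left_total : ∀ {f}, f ∈ A → ∃ g, S f g
  right_total : ∀ {g}, g ∈ B → ∃ f, S f g
  rho_eq : ∀ {f f' g g'}, S f g → S f' g' → rho c φ f f' = rho c φ g g'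

/-- The strong boundary points at which every `f` corresponding to a peaker at `y` has modulus
`r`. -/
def inducedPoints {X Y : Type*} [TopologicalSpace X] [TopologicalSpace Y]
    (A : Set C₀(X, ℂ)) (B : Set C₀(Y, ℂ)) (S : C₀(X, ℂ) → C₀(Y, ℂ) → Prop) (r : ℝ) (y : Y) :
    Set X :=
  {x ∈ strongBoundary A | ∀ f g, S f g → IsPeaker B r y g → ‖f x‖ = r}

namespace IsRhoCorrespondence

variable {X Y : Type*} [TopologicalSpace X] [TopologicalSpace Y] {c : ℝ → ℝ → ℝ}
  {φ : ℂ × ℂ → ℝ} {A : Set C₀(X, ℂ)} {B : Set C₀(Y, ℂ)} {S : C₀(X, ℂ) → C₀(Y, ℂ) → Prop}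

theorem symm (h : IsRhoCorrespondence c φ A B S) :
    IsRhoCorrespondence c φ B A (fun g f => S f g) where
  combination := h.combination
  gauge := h.gauge
  left_cone := h.right_cone
  right_cone := h.left_cone
  left_mem := h.right_mem
  right_mem := h.left_mem
  left_total := h.right_total
  right_total := h.left_total
  rho_eq h₁ h₂ := (h.rho_eq h₁ h₂).symm

/-- `rho c φ f f` equals the diagonal value `rhoConst` at `‖f‖`, which is strictly increasing in the
norm. -/
theorem norm_le (h : IsRhoCorrespondence c φ A B S) {f : C₀(X, ℂ)} {g : C₀(Y, ℂ)}
    (hfg : S f g) : ‖g‖ ≤ ‖f‖ := by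
  by_contra! hlt
  have hg : g ≠ 0 := norm_pos_iff.1 ((norm_nonneg f).trans_lt hlt)
  obtain ⟨y, hy⟩ := exists_norm_apply_eq_norm hg
  have h1 : rho c φ f f ≤ rhoConst c φ ‖f‖ ‖f‖ :=
    rho_le_rhoConst h.combination h.gauge le_rfl le_rfl
  have h2 : rhoConst c φ ‖g‖ ‖g‖ ≤ rho c φ g g :=
    rhoConst_le_rho h.combination h.gauge (norm_nonneg _) (norm_nonneg _) hy.ge hy.ge
  have h3 : rhoConst c φ ‖f‖ ‖f‖ < rhoConst c φ ‖g‖ ‖g‖ :=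
    h.combination.strictMono (h.gauge.diag_lt (norm_nonneg _) hlt)
      (h.gauge.diag_lt (norm_nonneg _) hlt)
  rw [h.rho_eq hfg hfg] at h1
  linarith

theorem norm_eq (h : IsRhoCorrespondence c φ A B S) {f : C₀(X, ℂ)} {g : C₀(Y, ℂ)}
    (hfg : S f g) : ‖f‖ = ‖g‖ :=
  le_antisymm (h.symm.norm_le hfg) (h.norm_le hfg)

/-- `rho` sees only moduli, so `g` and `g'` have the same distance to every test peaker. This allows
a function to be rotated into a peaker. -/
theorem norm_apply_le_of_norm_eq (h : IsRhoCorrespondence c φ A B S) {f f' : C₀(X, ℂ)}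
    {g g' : C₀(Y, ℂ)} (hfg : S f g) (hfg' : S f' g') (hff' : ∀ x, ‖f x‖ = ‖f' x‖) {y : Y}
    (hy : y ∈ strongBoundary B) : ‖g y‖ ≤ ‖g' y‖ := by
  by_contra! hlt
  obtain ⟨R, hR, k, hk, hlt'⟩ :=
    h.right_cone.exists_large_rho_lt h.combination h.gauge hy hlt
  obtain ⟨l, hl⟩ := h.right_total hk.1
  have h1 : rhoConst c φ ‖g y‖ R ≤ rho c φ g k :=
    rhoConst_le_rho h.combination h.gauge (norm_nonneg _) hR.le le_rfl (by
      rw [hk.2.1, Complex.norm_real]; exact le_abs_self R)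
  rw [← h.rho_eq hfg hl, rho_congr h.gauge hff', h.rho_eq hfg' hl] at h1
  linarith

theorem norm_apply_eq_of_norm_eq (h : IsRhoCorrespondence c φ A B S) {f f' : C₀(X, ℂ)}
    {g g' : C₀(Y, ℂ)} (hfg : S f g) (hfg' : S f' g') (hff' : ∀ x, ‖f x‖ = ‖f' x‖) {y : Y}
    (hy : y ∈ strongBoundary B) : ‖g y‖ = ‖g' y‖ :=
  le_antisymm (h.norm_apply_le_of_norm_eq hfg hfg' hff' hy)
    (h.norm_apply_le_of_norm_eq hfg' hfg (fun x => (hff' x).symm) hy)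

/-- If the midpoint of two peakers corresponds to `f`, then the functions corresponding to the
two peakers attain their norm at all boundary points where `f` does. -/
theorem norm_apply_eq_of_midpoint (h : IsRhoCorrespondence c φ A B S) {f f₁ f₂ : C₀(X, ℂ)}
    {g₁ g₂ : C₀(Y, ℂ)} {r : ℝ} (hr : 0 < r) (hf₁ : S f₁ g₁) (hf₂ : S f₂ g₂)
    (hg₁ : ‖g₁‖ = r) (hg₂ : ‖g₂‖ = r) (hf : S f ((1 / 2 : ℂ) • (g₁ + g₂))) {x : X}
    (hx : x ∈ strongBoundary A) (hfx : ‖f x‖ = r) : ‖f₁ x‖ = r := by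
  have hn₁ : ‖f₁‖ = r := (h.norm_eq hf₁).trans hg₁
  have hn₂ : ‖f₂‖ = r := (h.norm_eq hf₂).trans hg₂
  refine le_antisymm ((norm_apply_le f₁ x).trans hn₁.le) ?_
  by_contra! hlt
  have hr0 : (r : ℂ) ≠ 0 := by exact_mod_cast hr.ne'
  obtain ⟨k, hk, hlt'⟩ := h.left_cone.exists_rho_lt h.combination h.gauge hx hlt hr
    (by rw [hn₁]; exact (h.gauge.inc.2 _ _ (by simpa using hr.ne') _ hr0).2)
    (by rw [hn₁]; exact (h.gauge.inc.2 _ _ (by simpa using hr.ne') _ hr0).1)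
  obtain ⟨l, hl⟩ := h.left_total hk.1
  have h1 : rhoConst c φ r r ≤ rho c φ f k :=
    rhoConst_le_rho h.combination h.gauge hr.le hr.le hfx.ge (by
      rw [hk.2.1, Complex.norm_real]; exact le_abs_self r)
  have h2 : rho c φ f₂ k ≤ rhoConst c φ r r :=
    rho_le_rhoConst h.combination h.gauge hn₂.le hk.2.2.le
  have h3 := rho_midpoint_le h.combination h.gauge g₁ g₂ l
  rw [← h.rho_eq hf hl, ← h.rho_eq hf₁ hl, ← h.rho_eq hf₂ hl] at h3
  linarith

theorem inducedPoints_nonempty [T2Space X] (h : IsRhoCorrespondence c φ A B S) {y : Y}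
    (hy : y ∈ strongBoundary B) {r : ℝ} (hr : 0 < r) : (inducedPoints A B S r y).Nonempty := by
  let ι := {f : C₀(X, ℂ) // ∃ g, S f g ∧ IsPeaker B r y g}
  have hnorm : ∀ f : ι, ‖f.1‖ = r := fun f => by
    obtain ⟨g, hfg, hg⟩ := f.2
    exact (h.norm_eq hfg).trans hg.2.2
  have hne0 : ∀ f : ι, f.1 ≠ 0 := fun f => norm_pos_iff.1 (by rw [hnorm f]; exact hr)
  have hmemA : ∀ f : ι, f.1 ∈ A := fun f => by
    obtain ⟨g, hfg, -⟩ := f.2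
    exact h.left_mem hfg
  obtain ⟨k, hk, -⟩ := h.right_cone.exists_isPeaker hy hr one_pos univ_mem
  obtain ⟨k', hk'⟩ := h.right_total hk.1
  have hι : Nonempty ι := ⟨⟨k', k, hk', hk⟩⟩
  let M : ι → Set X := fun f => {x | r ≤ ‖f.1 x‖}
  have hMcomp : ∀ f, IsCompact (M f) := fun f => isCompact_setOf_le_norm_apply f.1 hr
  have hMmem : ∀ (f : ι) x, x ∈ M f ↔ ‖f.1 x‖ = r := fun f x =>
    ⟨fun hx => le_antisymm ((norm_apply_le f.1 x).trans (hnorm f).le) hx, fun hx => hx.ge⟩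
  -- Midpoints control maximum-modulus points only on the boundary, where peakers exist. The closure
  -- restores compactness and stays inside `M f`.
  let K : ι → Set X := fun f => closure (M f ∩ strongBoundary A)
  have hKM : ∀ f, K f ⊆ M f := fun f =>
    closure_minimal Set.inter_subset_left (hMcomp f).isClosed
  have hdir : Directed (· ⊇ ·) K := by
    intro f₁ f₂
    obtain ⟨g₁, hfg₁, hg₁⟩ := f₁.2
    obtain ⟨g₂, hfg₂, hg₂⟩ := f₂.2
    have hmid : IsPeaker B r y ((1 / 2 : ℂ) • (g₁ + g₂)) := by
      have hval : ((1 / 2 : ℂ) • (g₁ + g₂)) y = r := by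
        simp [hg₁.2.1, hg₂.2.1]; ring
      refine ⟨?_, hval, le_antisymm ?_ ?_⟩
      · have := h.right_cone.smul_mem (r := 1 / 2) (by norm_num)
          (h.right_cone.add_mem hg₁.1 hg₂.1)
        convert this using 2
        push_cast
        rfl
      · rw [norm_smul]
        have := norm_add_le g₁ g₂
        rw [hg₁.2.2, hg₂.2.2] at this
        norm_num
        linarith
      · refine le_trans ?_ (norm_apply_le _ y)
        rw [hval, Complex.norm_real]
        exact le_abs_self r
    obtain ⟨f, hf⟩ := h.right_total hmid.1
    have hmid' := hf
    rw [add_comm] at hmid'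
    refine ⟨⟨f, _, hf, hmid⟩, closure_mono ?_, closure_mono ?_⟩
    · rintro x ⟨hx, hxA⟩
      refine ⟨(hMmem f₁ x).2 ?_, hxA⟩
      exact h.norm_apply_eq_of_midpoint hr hfg₁ hfg₂ hg₁.2.2 hg₂.2.2 hf hxA
        ((hMmem ⟨f, _, hf, hmid⟩ x).1 hx)
    · rintro x ⟨hx, hxA⟩
      refine ⟨(hMmem f₂ x).2 ?_, hxA⟩
      exact h.norm_apply_eq_of_midpoint hr hfg₂ hfg₁ hg₂.2.2 hg₁.2.2 hmid' hxA
        ((hMmem ⟨f, _, hf, hmid⟩ x).1 hx)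
  have hKne : ∀ f, (K f).Nonempty := by
    intro f
    obtain ⟨x, hx⟩ := exists_norm_apply_eq_norm (hne0 f)
    obtain ⟨z, hz, hzA⟩ := h.left_cone.exists_boundary (hmemA f) (hne0 f) x hx
    exact ⟨z, subset_closure ⟨(hMmem f z).2 ((hzA f.1 (hmemA f) hx).trans (hnorm f)), hz⟩⟩
  obtain ⟨x, hx⟩ := IsCompact.nonempty_iInter_of_directed_nonempty_isCompact_isClosed K hdir hKne
    (fun f => (hMcomp f).of_isClosed_subset isClosed_closure (hKM f)) fun f => isClosed_closure
  have hxM : ∀ f : ι, ‖f.1 x‖ = ‖f.1‖ := fun f => by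
    rw [hnorm f]
    exact (hMmem f x).1 (hKM f (Set.mem_iInter.1 hx f))
  obtain ⟨f₀⟩ := hι
  -- The common point `x` is only a limit of boundary points; `z` lies on the boundary and keeps all
  -- the maxima.
  obtain ⟨z, hz, hzA⟩ := h.left_cone.exists_boundary (hmemA f₀) (hne0 f₀) x (hxM f₀)
  refine ⟨z, hz, fun f g hfg hg => ?_⟩
  let f' : ι := ⟨f, g, hfg, hg⟩
  exact (hzA f (h.left_mem hfg) (hxM f')).trans (hnorm f')

theorem exists_isPeaker_lt [T2Space X] (hA : IsBoundaryCone A) {x z : X}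
    (hx : x ∈ strongBoundary A) (hxz : z ≠ x) {r : ℝ} (hr : 0 < r) :
    ∃ k, IsPeaker A r x k ∧ ‖k z‖ < r := by
  obtain ⟨k, hk, hkV⟩ := hA.exists_isPeaker hx hr one_pos (isOpen_ne.mem_nhds hxz.symm)
  exact ⟨k, hk, by simpa using hkV z (by simp)⟩

/-- Let `y'` be induced by `x`. Were `y' ≠ y`, a peaker `g` at `y` with `‖g y'‖ < r` would
correspond to some `f` of maximal modulus at `x`. Rotating `f` into a peaker makes its counterpart
have modulus `r` at `y'`, yet rotation does not change boundary moduli. -/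
theorem mem_inducedPoints_symm [T2Space X] [T2Space Y] (h : IsRhoCorrespondence c φ A B S)
    {x : X} {y : Y} (hy : y ∈ strongBoundary B) {r : ℝ} (hr : 0 < r)
    (hx : x ∈ inducedPoints A B S r y) : y ∈ inducedPoints B A (fun g f => S f g) r x := by
  obtain ⟨y', hy', hpeak⟩ := h.symm.inducedPoints_nonempty hx.1 hr
  suffices y' = y by subst this; exact ⟨hy', hpeak⟩
  by_contra hne
  obtain ⟨g, hg, hlt⟩ := exists_isPeaker_lt h.right_cone hy hne hr
  obtain ⟨f, hf⟩ := h.right_total hg.1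
  obtain ⟨f', hf', hff'⟩ := h.left_cone.exists_isPeaker_rotation (h.left_mem hf)
    (hx.2 f g hf hg) ((h.norm_eq hf).trans hg.2.2)
  obtain ⟨g', hg'⟩ := h.left_total hf'.1
  have h1 : ‖g' y'‖ = r := hpeak g' f' hg' hf'
  have h2 := h.norm_apply_eq_of_norm_eq hg' hf hff' hy'
  linarith

/-- Peakers at distinct `x` and `z` with disjoint bumps have `rho` below `rhoConst c φ r s`, whereas
their counterparts reach moduli `r` and `s` together at `y`. Allowing `r ≠ s` gives independence of
the height. -/
theorem eq_of_mem_inducedPoints [T2Space X] [T2Space Y] (h : IsRhoCorrespondence c φ A B S)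
    {x z : X} {y : Y} (hy : y ∈ strongBoundary B) {r s : ℝ} (hr : 0 < r) (hs : 0 < s)
    (hx : x ∈ inducedPoints A B S r y) (hz : z ∈ inducedPoints A B S s y) : x = z := by
  by_contra hne
  obtain ⟨U, W, hU, hW, hxU, hzW, hUW⟩ := t2_separation hne
  obtain ⟨f, hf, hfU⟩ := h.left_cone.exists_isPeaker hx.1 hr one_half_pos (hU.mem_nhds hxU)
  obtain ⟨f', hf', hfW⟩ := h.left_cone.exists_isPeaker hz.1 hs one_half_pos (hW.mem_nhds hzW)
  obtain ⟨g, hg⟩ := h.left_total hf.1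
  obtain ⟨g', hg'⟩ := h.left_total hf'.1
  have h1 : ‖g y‖ = r := (h.mem_inducedPoints_symm hy hr hx).2 g f hg hf
  have h2 : ‖g' y‖ = s := (h.mem_inducedPoints_symm hy hs hz).2 g' f' hg' hf'
  have h3 : rhoConst c φ r s ≤ rho c φ g g' :=
    rhoConst_le_rho h.combination h.gauge hr.le hs.le h1.ge h2.ge
  have hlt : ∀ {a b : ℝ}, 0 < a → 0 < b → ∀ {ψ : ℂ × ℂ → ℝ}, IsGauge ψ →
      ψ ((a : ℂ), ((b * (1 / 2) : ℝ) : ℂ)) < ψ ((a : ℂ), (b : ℂ)) := by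
    intro a b ha hb ψ hψ
    refine (hψ.inc.2 _ _ ?_ _ (by exact_mod_cast ha.ne')).2
    rw [Complex.norm_real, Complex.norm_real, Real.norm_of_nonneg hb.le,
      Real.norm_of_nonneg (by positivity)]
    linarith
  have hsmall : ∀ z ∈ W, ‖f z‖ ≤ r * (1 / 2) := fun z hz =>
    (hfU z fun hzU => Set.disjoint_left.1 hUW hzU hz).le
  have h4 : rho c φ f f' < rhoConst c φ r s := by
    refine h.combination.strictMono ?_ ?_
    · exact h.gauge.normPhi_lt_of_small (V := W) (by positivity) (by linarith) hs
        (by positivity) hsmall hf'.2.2.le (fun z hz => (hfW z hz).le)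
        (by rw [hf.2.2]; exact hlt hr hs h.gauge)
    · exact h.gauge.swap.normPhi_lt_of_small (V := W) (by positivity) (by linarith) hs
        (by positivity) hsmall hf'.2.2.le (fun z hz => (hfW z hz).le)
        (by rw [hf.2.2]; exact hlt hr hs h.gauge.swap)
  rw [h.rho_eq hg hg'] at h4
  linarith

/-- A peaker at `x` corresponds to a function of the same height at `y`, so the peaker test
transfers. All heights are needed, since the test chooses `R`. -/
theorem norm_apply_le_of_mem_inducedPoints [T2Space X] [T2Space Y]
    (h : IsRhoCorrespondence c φ A B S) {x : X} {y : Y} (hy : y ∈ strongBoundary B)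
    (hx : ∀ r, 0 < r → x ∈ inducedPoints A B S r y) {f : C₀(X, ℂ)} {g : C₀(Y, ℂ)}
    (hfg : S f g) : ‖g y‖ ≤ ‖f x‖ := by
  by_contra! hlt
  obtain ⟨R, hR, k, hk, hlt'⟩ :=
    h.left_cone.exists_large_rho_lt h.combination h.gauge (hx 1 one_pos).1 hlt
  obtain ⟨l, hl⟩ := h.left_total hk.1
  have h1 : ‖l y‖ = R := (h.mem_inducedPoints_symm hy hR (hx R hR)).2 l k hl hk
  have h2 : rhoConst c φ ‖g y‖ R ≤ rho c φ g l :=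
    rhoConst_le_rho h.combination h.gauge (norm_nonneg _) hR.le le_rfl h1.ge
  rw [← h.rho_eq hfg hl] at h2
  linarith

theorem exists_unique_point [T2Space X] [T2Space Y] (h : IsRhoCorrespondence c φ A B S) {y : Y}
    (hy : y ∈ strongBoundary B) : ∃ x, ∀ r, 0 < r → inducedPoints A B S r y = {x} := by
  obtain ⟨x, hx⟩ := h.inducedPoints_nonempty hy one_pos
  refine ⟨x, fun r hr => Set.eq_singleton_iff_unique_mem.2 ⟨?_, fun z hz => ?_⟩⟩
  · obtain ⟨z, hz⟩ := h.inducedPoints_nonempty hy hr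
    rwa [h.eq_of_mem_inducedPoints hy one_pos hr hx hz]
  · exact h.eq_of_mem_inducedPoints hy hr one_pos hz hx

/-- If `f` peaks at `Φ y` and is below `1/2` off `V`, then `{‖g‖ > 1/2}` is a neighbourhood of `y`
sent into `V`. -/
theorem continuous_of_norm_apply_eq (h : IsRhoCorrespondence c φ A B S)
    {Φ : strongBoundary B → strongBoundary A}
    (hΦ : ∀ f g, S f g → ∀ y : strongBoundary B, ‖g y‖ = ‖f (Φ y)‖) : Continuous Φ := by
  refine continuous_induced_rng.2 (continuous_iff_continuousAt.2 fun y V hV => ?_)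
  obtain ⟨f, hf, hfx, -, hfV⟩ := (Φ y).2 (1 / 2) one_half_pos V hV
  obtain ⟨g, hg⟩ := h.left_total hf
  have hopen : IsOpen {w : strongBoundary B | 1 / 2 < ‖g w‖} :=
    isOpen_lt continuous_const ((map_continuous g).norm.comp continuous_subtype_val)
  have hy : y ∈ {w : strongBoundary B | 1 / 2 < ‖g w‖} := by
    change 1 / 2 < ‖g y‖
    rw [hΦ f g hg y, hfx, norm_one]
    norm_num
  refine mem_map.2 (mem_of_superset (hopen.mem_nhds hy) fun w hw => ?_)
  by_contra hwV
  have h1 := hfV _ hwV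
  have h2 : 1 / 2 < ‖g w‖ := hw
  rw [hΦ f g hg w] at h2
  exact lt_asymm h1 h2

theorem exists_homeomorph [T2Space X] [T2Space Y] (h : IsRhoCorrespondence c φ A B S) :
    ∃ Φ : strongBoundary B ≃ₜ strongBoundary A,
      (∀ (y : strongBoundary B) (r : ℝ), 0 < r → inducedPoints A B S r y = {(Φ y : X)}) ∧
      ∀ f g, S f g → ∀ y : strongBoundary B, ‖g y‖ = ‖f (Φ y)‖ := by
  choose Φ hΦ using fun y : strongBoundary B => h.exists_unique_point y.2
  choose Ψ hΨ using fun x : strongBoundary A => h.symm.exists_unique_point x.2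
  have hΦmem : ∀ (y : strongBoundary B) r, 0 < r → Φ y ∈ inducedPoints A B S r y := by
    intro y r hr
    rw [hΦ y r hr]; rfl
  have hΨmem : ∀ (x : strongBoundary A) r, 0 < r →
      Ψ x ∈ inducedPoints B A (fun g f => S f g) r x := by
    intro x r hr
    rw [hΨ x r hr]; rfl
  let Φ' : strongBoundary B → strongBoundary A := fun y => ⟨Φ y, (hΦmem y 1 one_pos).1⟩
  let Ψ' : strongBoundary A → strongBoundary B := fun x => ⟨Ψ x, (hΨmem x 1 one_pos).1⟩
  have hnorm : ∀ f g, S f g → ∀ y : strongBoundary B, ‖g y‖ = ‖f (Φ' y)‖ := by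
    intro f g hfg y
    refine le_antisymm (h.norm_apply_le_of_mem_inducedPoints y.2 (hΦmem y) hfg) ?_
    exact h.symm.norm_apply_le_of_mem_inducedPoints (Φ' y).2
      (fun r hr => h.mem_inducedPoints_symm y.2 hr (hΦmem y r hr)) hfg
  have hnorm' : ∀ f g, S f g → ∀ x : strongBoundary A, ‖f x‖ = ‖g (Ψ' x)‖ := by
    intro f g hfg x
    refine le_antisymm (h.symm.norm_apply_le_of_mem_inducedPoints x.2 (hΨmem x) hfg) ?_
    exact h.norm_apply_le_of_mem_inducedPoints (Ψ' x).2
      (fun r hr => h.symm.mem_inducedPoints_symm x.2 hr (hΨmem x r hr)) hfg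
  refine ⟨⟨⟨Φ', Ψ', fun y => Subtype.ext ?_, fun x => Subtype.ext ?_⟩,
    h.continuous_of_norm_apply_eq hnorm,
    h.symm.continuous_of_norm_apply_eq fun g f hfg => hnorm' f g hfg⟩, hΦ, hnorm⟩
  · have h1 := h.mem_inducedPoints_symm y.2 one_pos (hΦmem y 1 one_pos)
    exact h.symm.eq_of_mem_inducedPoints (Φ' y).2 one_pos one_pos (hΨmem (Φ' y) 1 one_pos) h1
  · have h1 := h.symm.mem_inducedPoints_symm x.2 one_pos (hΨmem x 1 one_pos)
    exact h.eq_of_mem_inducedPoints (Ψ' x).2 one_pos one_pos (hΦmem (Ψ' x) 1 one_pos) h1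

end IsRhoCorrespondence

end Correspondence

/-! ### Subspaces and positive cones as boundary cones -/

section Cones

variable {X : Type*} [TopologicalSpace X] [T2Space X] [LocallyCompactSpace X]

theorem IsSubspace.isBoundaryCone {A : Set C₀(X, ℂ)} (hA : IsSubspace A)
    {E : Submodule ℂ C₀(X, ℂ)} (hδ : strongBoundary A = choquetBoundary E)
    (hAE : absSet A ⊆ absSet (E : Set C₀(X, ℂ))) : IsBoundaryCone A where
  add_mem hf hg := by
    obtain ⟨F, rfl⟩ := hA
    exact F.add_mem hf hg
  smul_mem _ hf := by
    obtain ⟨F, rfl⟩ := hA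
    exact F.smul_mem _ hf
  exists_rotation {f} hf x := by
    obtain ⟨F, rfl⟩ := hA
    obtain ⟨c, hc, hcf⟩ := exists_norm_one_mul_eq_norm (f x)
    exact ⟨c • f, F.smul_mem c hf, fun z => by simp [hc], hcf⟩
  exists_boundary hf₀ hne x₀ hx₀ := by
    rw [hδ]
    exact exists_mem_choquetBoundary_of_absSet_subset hAE x₀ hf₀ hne hx₀

theorem IsPositiveCone.isBoundaryCone {A : Set C₀(X, ℂ)} (hA : IsPositiveCone A)
    {E : Submodule ℂ C₀(X, ℂ)} (hδ : strongBoundary A = choquetBoundary E)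
    (hAE : absSet A ⊆ absSet (E : Set C₀(X, ℂ))) : IsBoundaryCone A where
  add_mem hf hg := by
    obtain ⟨F, rfl⟩ := hA
    refine ⟨F.add_mem hf.1 hg.1, fun x => ⟨?_, ?_⟩⟩
    · simpa using add_nonneg (hf.2 x).1 (hg.2 x).1
    · simp [(hf.2 x).2, (hg.2 x).2]
  smul_mem hr hf := by
    obtain ⟨F, rfl⟩ := hA
    refine ⟨F.smul_mem _ hf.1, fun x => ⟨?_, ?_⟩⟩
    · simpa using mul_nonneg hr (hf.2 x).1
    · simp [(hf.2 x).2]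
  exists_rotation {f} hf x := by
    refine ⟨f, hf, fun _ => rfl, ?_⟩
    obtain ⟨F, rfl⟩ := hA
    obtain ⟨h0, h1⟩ := hf.2 x
    exact (Complex.eq_coe_norm_of_nonneg (Complex.nonneg_iff.2 ⟨h0, h1.symm⟩))
  exists_boundary hf₀ hne x₀ hx₀ := by
    rw [hδ]
    exact exists_mem_choquetBoundary_of_absSet_subset hAE x₀ hf₀ hne hx₀

end Cones

theorem IsBoundaryCone.mem_smul_peakers_iff {Y : Type*} [TopologicalSpace Y] {B : Set C₀(Y, ℂ)}
    (hB : IsBoundaryCone B) {r : ℝ} (hr : 0 < r) {y : Y} {g : C₀(Y, ℂ)} :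
    g ∈ (fun v => (r : ℂ) • v) '' peakers B y ↔ IsPeaker B r y g := by
  have hr0 : (r : ℂ) ≠ 0 := by exact_mod_cast hr.ne'
  constructor
  · rintro ⟨v, ⟨hv, hvy, hvn⟩, rfl⟩
    refine ⟨hB.smul_mem hr.le hv, by simp [hvy], ?_⟩
    change ‖(r : ℂ) • v‖ = r
    rw [norm_smul, hvn, Complex.norm_real, Real.norm_of_nonneg hr.le, mul_one]
  · rintro ⟨hg, hgy, hgn⟩
    refine ⟨((r⁻¹ : ℝ) : ℂ) • g, ⟨hB.smul_mem (inv_nonneg.2 hr.le) hg, ?_, ?_⟩, ?_⟩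
    · simp [hgy, hr0]
    · rw [norm_smul, hgn, Complex.norm_real, Real.norm_of_nonneg (inv_nonneg.2 hr.le),
        inv_mul_cancel₀ hr.ne']
    · change (r : ℂ) • ((r⁻¹ : ℝ) : ℂ) • g = g
      rw [Complex.ofReal_inv, smul_inv_smul₀ hr0]

/-! ### The graph of a surjective `rho`-preserving map -/

section Map

variable {X Y : Type*} [TopologicalSpace X] [TopologicalSpace Y] {c : ℝ → ℝ → ℝ}
  {φ : ℂ × ℂ → ℝ} {A : Set C₀(X, ℂ)} {B : Set C₀(Y, ℂ)}

/-- The graph of a map `T : A → B`. -/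
def graphRel (T : A → B) (f : C₀(X, ℂ)) (g : C₀(Y, ℂ)) : Prop :=
  ∃ hf : f ∈ A, (T ⟨f, hf⟩ : C₀(Y, ℂ)) = g

theorem isRhoCorrespondence_graphRel (hc : IsCombination c) (hφ : IsGauge φ)
    (hA : IsBoundaryCone A) (hB : IsBoundaryCone B) {T : A → B} (hT : Function.Surjective T)
    (hρ : ∀ f g : A, rho c φ (T f : C₀(Y, ℂ)) (T g) = rho c φ (f : C₀(X, ℂ)) g) :
    IsRhoCorrespondence c φ A B (graphRel T) where
  combination := hc
  gauge := hφ
  left_cone := hA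
  right_cone := hB
  left_mem h := h.1
  right_mem := by
    rintro f _ ⟨hf, rfl⟩
    exact (T ⟨f, hf⟩).2
  left_total hf := ⟨_, hf, rfl⟩
  right_total {g} hg := by
    obtain ⟨f, hf⟩ := hT ⟨g, hg⟩
    exact ⟨f, f.2, by rw [hf]⟩
  rho_eq := by
    rintro f f' _ _ ⟨hf, rfl⟩ ⟨hf', rfl⟩
    exact (hρ ⟨f, hf⟩ ⟨f', hf'⟩).symm

theorem IsRhoCorrespondence.inducedSet_inter_eq {T : A → B}
    (h : IsRhoCorrespondence c φ A B (graphRel T)) {r : ℝ} (hr : 0 < r) (y : Y) :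
    inducedSet T r y ∩ strongBoundary A = inducedPoints A B (graphRel T) r y := by
  have key : ∀ (f : A), IsPeaker B r y (T f) → ‖(f : C₀(X, ℂ))‖ = r := fun f hf =>
    (h.norm_eq ⟨f.2, rfl⟩).trans hf.2.2
  ext x
  constructor
  · rintro ⟨hx, hxA⟩
    refine ⟨hxA, ?_⟩
    rintro f _ ⟨hf, rfl⟩ hg
    exact (hx ⟨f, hf⟩ ((h.right_cone.mem_smul_peakers_iff hr).2 hg)).trans (key ⟨f, hf⟩ hg)
  · rintro ⟨hxA, hx⟩
    refine ⟨fun f hf => ?_, hxA⟩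
    have hg := (h.right_cone.mem_smul_peakers_iff hr).1 hf
    exact (hx f (T f) ⟨f.2, rfl⟩ hg).trans (key f hg).symm

theorem IsRhoCorrespondence.exists_homeomorph_of_graphRel [T2Space X] [T2Space Y] {T : A → B}
    (h : IsRhoCorrespondence c φ A B (graphRel T)) :
    ∃ Φ : strongBoundary B ≃ strongBoundary A,
      (∀ (y : strongBoundary B) (r : ℝ), 0 < r →
        inducedSet T r (y : Y) ∩ strongBoundary A = {(Φ y : X)}) ∧
      IsHomeomorph Φ ∧ ∀ (f : A) (y : strongBoundary B),
        ‖(T f : C₀(Y, ℂ)) y‖ = ‖(f : C₀(X, ℂ)) (Φ y)‖ := by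
  obtain ⟨Φ, hΦ, hnorm⟩ := h.exists_homeomorph
  exact ⟨Φ.toEquiv, fun y r hr => by rw [h.inducedSet_inter_eq hr]; exact hΦ y r hr,
    Φ.isHomeomorph, fun f y => hnorm f (T f) ⟨f.2, rfl⟩ y⟩

end Map

end CompModulus

/-! ### The main theorem -/

theorem theorem4
    {X Y : Type*} [TopologicalSpace X] [T2Space X] [LocallyCompactSpace X]
    [TopologicalSpace Y] [T2Space Y] [LocallyCompactSpace Y]
    (φ : ℂ × ℂ → ℝ) (hφ_nonneg : ∀ p, 0 ≤ φ p) (hφ_cont : Continuous φ)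
    (hφ_inc : CompModulus.Inc φ) (hφ_con : CompModulus.Con φ)
    (A : Set C₀(X, ℂ)) (B : Set C₀(Y, ℂ))
    (hAB : (CompModulus.IsSubspace A ∧ CompModulus.IsSubspace B) ∨
      (CompModulus.IsPositiveCone A ∧ CompModulus.IsPositiveCone B))
    (𝒜 : NonUnitalSubalgebra ℂ C₀(X, ℂ)) (ℬ : NonUnitalSubalgebra ℂ C₀(Y, ℂ))
    (h𝒜 : CompModulus.IsFunctionAlgebra 𝒜) (hℬ : CompModulus.IsFunctionAlgebra ℬ)
    (hδA : CompModulus.strongBoundary A = CompModulus.choquetBoundary 𝒜.toSubmodule)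
    (hδB : CompModulus.strongBoundary B = CompModulus.choquetBoundary ℬ.toSubmodule)
    (hA_abs : CompModulus.absSet A ⊆ CompModulus.absSet (𝒜 : Set C₀(X, ℂ)))
    (hB_abs : CompModulus.absSet B ⊆ CompModulus.absSet (ℬ : Set C₀(Y, ℂ)))
    (T : A → B) (hT_surj : Function.Surjective T)
    (hT : (∀ f g : A, CompModulus.rhoMax φ (T f : C₀(Y, ℂ)) (T g)
            = CompModulus.rhoMax φ (f : C₀(X, ℂ)) g) ∨
      (∀ f g : A, CompModulus.rhoPlus φ (T f : C₀(Y, ℂ)) (T g)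
            = CompModulus.rhoPlus φ (f : C₀(X, ℂ)) g)) :
    ∃ Φ : CompModulus.choquetBoundary ℬ.toSubmodule ≃ CompModulus.choquetBoundary 𝒜.toSubmodule,
      (∀ (y : CompModulus.choquetBoundary ℬ.toSubmodule) (r : ℝ), 0 < r →
        CompModulus.inducedSet T r (y : Y) ∩ CompModulus.choquetBoundary 𝒜.toSubmodule
          = {(Φ y : X)}) ∧
      ((∀ f g : A, CompModulus.rhoMax φ (T f : C₀(Y, ℂ)) (T g)
          = CompModulus.rhoMax φ (f : C₀(X, ℂ)) g) →
        IsHomeomorph Φ ∧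
          ∀ (f : A) (y : CompModulus.choquetBoundary ℬ.toSubmodule),
            ‖(T f : C₀(Y, ℂ)) y‖ = ‖(f : C₀(X, ℂ)) (Φ y)‖) ∧
      ((∀ f g : A, CompModulus.rhoPlus φ (T f : C₀(Y, ℂ)) (T g)
          = CompModulus.rhoPlus φ (f : C₀(X, ℂ)) g) →
        ((∀ t : ℝ, 0 ≤ t → φ ((t : ℂ), 0) = 0 ∧ φ (0, (t : ℂ)) = 0) ∨
          (∀ a : ℝ, 0 < a → Tendsto (fun t : ℝ => φ ((t : ℂ), (a : ℂ))) atTop atTop ∧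
            Tendsto (fun t : ℝ => φ ((a : ℂ), (t : ℂ))) atTop atTop)) →
        IsHomeomorph Φ ∧
          ∀ (f : A) (y : CompModulus.choquetBoundary ℬ.toSubmodule),
            ‖(T f : C₀(Y, ℂ)) y‖ = ‖(f : C₀(X, ℂ)) (Φ y)‖) := by
  have hφ : CompModulus.IsGauge φ := ⟨hφ_nonneg, hφ_cont, hφ_inc, hφ_con⟩
  have hA : CompModulus.IsBoundaryCone A :=
    hAB.elim (fun h => h.1.isBoundaryCone hδA hA_abs) fun h => h.1.isBoundaryCone hδA hA_abs
  have hB : CompModulus.IsBoundaryCone B :=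
    hAB.elim (fun h => h.2.isBoundaryCone hδB hB_abs) fun h => h.2.isBoundaryCone hδB hB_abs
  rw [← hδA, ← hδB]
  -- From here the argument is the same for maximum and sum, so one `Φ` serves all clauses.
  have hex : ∃ c : ℝ → ℝ → ℝ,
      CompModulus.IsRhoCorrespondence c φ A B (CompModulus.graphRel T) := by
    rcases hT with hT | hT
    · exact ⟨_, CompModulus.isRhoCorrespondence_graphRel CompModulus.isCombination_max hφ hA hB
        hT_surj hT⟩
    · exact ⟨_, CompModulus.isRhoCorrespondence_graphRel CompModulus.isCombination_add hφ hA hB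
        hT_surj hT⟩
  obtain ⟨c, h⟩ := hex
  obtain ⟨Φ, hΦ, hhom⟩ := h.exists_homeomorph_of_graphRel
  exact ⟨Φ, hΦ, fun _ => hhom, fun _ _ => hhom⟩
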